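/- Let $\Gamma$ be a finite simplicial graph with vertex set $S$ whose edges are labeled by integers $\ge 2$, and let $A_S$ be the Artin group with presentation graph $\Gamma$: it is generated by $S$, with one relation $sts\cdots = tst\cdots$ (alternating words of length $m$ on both sides) for each edge $\{s,t\}$ of $\Gamma$ with label $m$. The Dynkin diagram $\Lambda$ of $A_S$ is the graph with vertex set $S$ in which distinct $s,t$ are adjacent unless $\{s,t\}$ is an edge of $\Gamma$ labeled $2$. For $s\in S$, let $A_{\hat s}\le A_S$ be the subgroup generated by $S\setminus\{s\}$. For an induced subgraph $\Lambda'$ of $\Lambda$ with vertex set $S'\subset S$, the relative Artin complex $\Delta_{\Lambda,\Lambda'}$ is the simplicial complex whose vertices are the left cosets of the subgroups $A_{\hat s}$, $s\in S'$ (a coset of $A_{\hat s}$ has label $s$), where a finite set of vertices spans a simplex if the cosets have a nonempty common intersection. An induced subgraph $\Lambda'$ of $\Lambda$ is admissible if for every vertex $x$ of $\Lambda'$, any two vertices of $\Lambda'$ in different components of $\Lambda'\setminus\{x\}$ are in different components of $\Lambda\setminus\{x\}$. A linear subgraph is an induced subgraph which is a path with at least one vertex. If $\Lambda'$ is an admissible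 tree, then $\Delta_{\Lambda,\Lambda'}$ satisfies the labeled 4-wheel condition if for every induced 4-cycle in its 1-skeleton (four distinct vertices $x_1,x_2,x_3,x_4$, cyclically consecutive ones adjacent, opposite ones not adjacent), with labels $s_1,s_2,s_3,s_4$, there is a vertex $x$ adjacent to each $x_i$ whose label lies in the smallest subtree of $\Lambda'$ containing $s_1,s_2,s_3,s_4$. **Proposition.** Let $\Lambda'$ be an admissible tree subgraph of $\Lambda$. Then $\Delta_{\Lambda,\Lambda'}$ satisfies the labeled 4-wheel condition if and only if for every maximal (with respect to inclusion) linear subgraph $\Lambda''$ of $\Lambda'$, the complex $\Delta_{\Lambda,\Lambda''}$ satisfies the labeled 4-wheel condition. -/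

import Mathlib

/-! ### Artin groups and Dynkin diagrams

A finite presentation graph with vertex set `S` and edge labels `≥ 2` is encoded by a Coxeter
matrix `M` on `S`: for `s ≠ t`, `M s t = 0` means that `s` and `t` are not adjacent in the
presentation graph (label `∞`), and `M s t ≥ 2` is the label of the edge joining them. -/

/-- The Artin relations: for distinct `s, t` with finite label `m = M s t`, the two alternating
words of length `m` in `s` and `t` are equal. -/
def artinRelations {S : Type*} (M : CoxeterMatrix S) : Set (FreeGroup S) :=
  {r | ∃ s t : S, s ≠ t ∧ M s t ≠ 0 ∧
    r = ((CoxeterSystem.alternatingWord s t (M s t)).map FreeGroup.of).prod *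
      ((CoxeterSystem.alternatingWord t s (M s t)).map FreeGroup.of).prod⁻¹}

/-- The Artin group of the Coxeter matrix `M`. -/
abbrev ArtinGroup {S : Type*} (M : CoxeterMatrix S) : Type _ :=
  PresentedGroup (artinRelations M)

/-- The standard parabolic subgroup generated by `T ⊆ S`. -/
def standardParabolic {S : Type*} (M : CoxeterMatrix S) (T : Set S) : Subgroup (ArtinGroup M) :=
  Subgroup.closure ((fun s : S => (PresentedGroup.of s : ArtinGroup M)) '' T)

/-- The Dynkin diagram: `s ≠ t` are joined by an edge unless their label is `2`.
(Edge labels play no role in what follows.) -/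
def dynkinDiagram {S : Type*} (M : CoxeterMatrix S) : SimpleGraph S where
  Adj s t := s ≠ t ∧ M s t ≠ 2
  symm := ⟨fun s t h => ⟨h.1.symm, by rw [M.symmetric t s]; exact h.2⟩⟩
  loopless := ⟨fun _ h => h.1 rfl⟩

/-! ### Induced subgraphs, given by their vertex sets -/

/-- The subgraph of `Λ` induced on `T` is admissible: if two of its vertices lie in different
components of the induced subgraph minus a vertex `x ∈ T`, then they lie in different
components of `Λ` minus `x`. -/
def IsAdmissible {S : Type*} (Λ : SimpleGraph S) (T : Set S) : Prop :=
  ∀ x ∈ T, ∀ (x₁ x₂ : S) (h₁ : x₁ ∈ T \ {x}) (h₂ : x₂ ∈ T \ {x}),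
    ¬ (Λ.induce (T \ {x})).Reachable ⟨x₁, h₁⟩ ⟨x₂, h₂⟩ →
    ¬ (Λ.induce ({x}ᶜ : Set S)).Reachable ⟨x₁, h₁.2⟩ ⟨x₂, h₂.2⟩

/-- The subgraph of `Λ` induced on `T` is linear: a path with at least one vertex. -/
def IsLinearSubgraph {S : Type*} (Λ : SimpleGraph S) (T : Set S) : Prop :=
  ∃ n : ℕ, Nonempty (Λ.induce T ≃g SimpleGraph.pathGraph (n + 1))

/-- `T''` spans a maximal linear subgraph of the subgraph of `Λ` induced on `T`. -/
def IsMaximalLinearSubgraph {S : Type*} (Λ : SimpleGraph S) (T T'' : Set S) : Prop :=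
  Maximal (fun U : Set S => U ⊆ T ∧ IsLinearSubgraph Λ U) T''

/-- If `T` induces a tree in `Λ` and `F ⊆ T` is nonempty, this is the vertex set of the smallest
subtree of that tree containing `F` (subtrees of a tree are closed under nonempty
intersections). -/
def smallestSubtree {S : Type*} (Λ : SimpleGraph S) (T F : Set S) : Set S :=
  ⋂₀ {U : Set S | U ⊆ T ∧ F ⊆ U ∧ (Λ.induce U).IsTree}

/-! ### Relative Artin complexes -/

/-- The vertices of the relative Artin complex `Δ_{S,T}`: pairs consisting of `s ∈ T` and a left
coset of `A_{S \ {s}}`. The first component `s` records that the vertex has type `ŝ`. -/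
abbrev RelArtinVertex {S : Type*} (M : CoxeterMatrix S) (T : Set S) : Type _ :=
  Σ s : T, ArtinGroup M ⧸ standardParabolic M ({(s : S)}ᶜ : Set S)

/-- The relative Artin complex `Δ_{S,T}`: a nonempty finite set of vertices spans a simplex if
the corresponding cosets have a common element `g`. -/
def relArtinComplex {S : Type*} (M : CoxeterMatrix S) (T : Set S) :
    AbstractSimplicialComplex (RelArtinVertex M T) where
  faces := {F | F.Nonempty ∧ ∃ g : ArtinGroup M, ∀ v ∈ F, QuotientGroup.mk g = v.2}
  isRelLowerSet_faces := fun _ hF =>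
    ⟨hF.1, fun _ hle hne => ⟨hne, hF.2.imp fun _ hg v hv => hg v (hle hv)⟩⟩
  singleton_mem v := ⟨Finset.singleton_nonempty v, by
    obtain ⟨g, hg⟩ := QuotientGroup.mk_surjective v.2
    exact ⟨g, fun w hw => by rw [Finset.mem_singleton.mp hw]; exact hg⟩⟩

open Classical in
/-- The 1-skeleton of an abstract simplicial complex, as a simple graph. -/
def oneSkeleton {V : Type*} (K : AbstractSimplicialComplex V) : SimpleGraph V where
  Adj v w := v ≠ w ∧ ({v, w} : Finset V) ∈ K.faces
  symm := ⟨fun v w h => ⟨h.1.symm, by rw [Finset.pair_comm]; exact h.2⟩⟩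
  loopless := ⟨fun _ h => h.1 rfl⟩

/-- `x₁, x₂, x₃, x₄` are the consecutive vertices of an induced 4-cycle of `X`: an embedded
4-cycle whose opposite vertices are not adjacent. -/
structure IsInducedFourCycle {V : Type*} (X : SimpleGraph V) (x₁ x₂ x₃ x₄ : V) : Prop where
  adj₁₂ : X.Adj x₁ x₂
  adj₂₃ : X.Adj x₂ x₃
  adj₃₄ : X.Adj x₃ x₄
  adj₄₁ : X.Adj x₄ x₁
  ne₁₃ : x₁ ≠ x₃
  ne₂₄ : x₂ ≠ x₄
  not_adj₁₃ : ¬ X.Adj x₁ x₃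
  not_adj₂₄ : ¬ X.Adj x₂ x₄

/-- The labeled 4-wheel condition for `Δ_{S,T}`, where `T` spans an admissible tree subgraph of
the Dynkin diagram: every induced 4-cycle of the 1-skeleton has a common neighbour `x` whose
label lies in the smallest subtree (of the tree spanned by `T`) containing the four labels. -/
def LabeledFourWheel {S : Type*} (M : CoxeterMatrix S) (T : Set S) : Prop :=
  ∀ x₁ x₂ x₃ x₄ : RelArtinVertex M T,
    IsInducedFourCycle (oneSkeleton (relArtinComplex M T)) x₁ x₂ x₃ x₄ →
    ∃ x : RelArtinVertex M T,
      (oneSkeleton (relArtinComplex M T)).Adj x x₁ ∧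
      (oneSkeleton (relArtinComplex M T)).Adj x x₂ ∧
      (oneSkeleton (relArtinComplex M T)).Adj x x₃ ∧
      (oneSkeleton (relArtinComplex M T)).Adj x x₄ ∧
      (x.1 : S) ∈ smallestSubtree (dynkinDiagram M) T
        {(x₁.1 : S), (x₂.1 : S), (x₃.1 : S), (x₄.1 : S)}

/-!
The relative Artin complexes of a tree and of its linear subgraphs are compared through
intersections of cosets: two distinct vertices are adjacent exactly when their cosets meet.

One direction is immediate, since an induced 4-cycle with labels in a linear subgraph `T''` is one
with labels in `T`, and the subtrees of `T''` are among those of `T`.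

For the other direction, it is enough to have centers for the induced 4-cycles with only two
distinct labels (`hasCenter_of_two_labels`); their labels lie on a path, so that the hypothesis on
maximal linear subgraphs applies. Two facts carry the reduction.

* Separation (`Meets.trans_of_btw`). If `y` is adjacent to `x` and `z`, and the label `r` of `y`
  separates the labels of `x` and `z` in the tree, then by admissibility it does so in the Dynkin
  diagram. Hence the parabolic subgroup omitting `r` is a product of two commuting parabolic
  subgroups, and the cosets of `x` and `z` meet.

* Projection (`exists_meets_of_walk`). In a 4-cycle `x₁, x₂, x₃, x₄` with labels `a, b, c, d`,
  every path from `c` to `b` contains the label of a vertex adjacent or equal to each of `x₁`,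
  `x₂`, `x₄`. It is obtained by applying to `x₃` the set-theoretic retraction of the Artin group
  onto the parabolic subgroup omitting `a`. The retraction is read off from an action of the Artin
  group on pairs `(g, u)`, where `u` is an element of the Coxeter group, in its geometric
  representation, which keeps the simple roots of `X = S \ {a}` positive. A generator `s` moves
  `u` to `s u` if this is again such an element; otherwise `u` maps the simple root of some
  `t ∈ X` to that of `s`, and `g` becomes `t g` (`altPerm_braid` gives the braid relations).
  On `x₃`, only those `t` are recorded for which the root `u α_t` does not involve `α_c`. As `u`
  lies in the parabolic subgroup omitting `b`, the coefficients of `α_c` cannot vanish for all `t`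
  on a path from `c` to `b` (`exists_mem_support_apply_ne_zero`), because the coordinate form of
  `α_c` is dominant. So some `r` on the path is never recorded, and the image of `x₃` lies in one
  coset of the parabolic subgroup omitting `r`.

Given an induced 4-cycle with more than two labels, some label, say that of `x₁`, does not lie on
the paths joining the three others. The projection of `x₃` to the link of `x₁` gives a vertex `y`;
if it does not meet `x₃`, then `y, x₂, x₃, x₄` is an induced 4-cycle spanning a smaller subtree,
and so has a center `w`. If `w` does not meet `x₁`, then `x₁, x₂, w, x₄` spans a smaller subtree
as well, and separation shows that its center meets `x₃` (`hasCenter_of_isOuter`).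
-/

set_option linter.unusedSectionVars false

namespace CoxeterMatrix

open CoxeterSystem (alternatingWord alternatingWord_succ alternatingWord_succ')

variable {S : Type*} [Fintype S] [DecidableEq S] (M : CoxeterMatrix S)

/-! ### The geometric representation of a Coxeter matrix -/

/-- The simple root attached to `s`: the `s`-th standard basis vector. -/
def simpleRoot (s : S) : S → ℝ := Pi.single s 1

/-- The simple coroot attached to `s`, i.e. twice the canonical bilinear form paired with the
simple root of `s`. For an infinite label, encoded as `0`, the coefficient is
`-2 * cos (π / 0) = -2`, as it should be. -/
noncomputable def simpleCoroot (s : S) : Module.Dual ℝ (S → ℝ) :=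
  ∑ t, (-2 * Real.cos (Real.pi / M s t)) • LinearMap.proj t

lemma simpleCoroot_apply (s : S) (x : S → ℝ) :
    M.simpleCoroot s x = ∑ t, (-2 * Real.cos (Real.pi / M s t)) * x t := by
  simp [simpleCoroot]

lemma simpleCoroot_simpleRoot (s t : S) :
    M.simpleCoroot s (simpleRoot t) = -2 * Real.cos (Real.pi / M s t) := by
  rw [simpleCoroot_apply, Finset.sum_eq_single t] <;> simp +contextual [simpleRoot]

lemma simpleCoroot_self (s : S) : M.simpleCoroot s (simpleRoot s) = 2 := by
  simp [simpleCoroot_simpleRoot]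

/-- The simple reflection attached to `s` in the geometric representation. -/
noncomputable def simpleRefl (s : S) : (S → ℝ) ≃ₗ[ℝ] (S → ℝ) :=
  Module.reflection (M.simpleCoroot_self s)

lemma simpleRefl_apply (s : S) (x : S → ℝ) :
    M.simpleRefl s x = x - M.simpleCoroot s x • simpleRoot s :=
  Module.reflection_apply _ _

lemma simpleRefl_simpleRoot_self (s : S) : M.simpleRefl s (simpleRoot s) = -simpleRoot s :=
  Module.reflection_apply_self _

lemma simpleRefl_mul_self (s : S) : M.simpleRefl s * M.simpleRefl s = 1 := by
  ext1 x
  exact Module.involutive_reflection (M.simpleCoroot_self s) x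

lemma simpleRefl_simpleRefl (s : S) (x : S → ℝ) : M.simpleRefl s (M.simpleRefl s x) = x :=
  Module.involutive_reflection (M.simpleCoroot_self s) x

lemma simpleRefl_apply_of_ne {s r : S} (h : r ≠ s) (x : S → ℝ) : M.simpleRefl s x r = x r := by
  simp [simpleRefl_apply, simpleRoot, h]

lemma simpleRoot_nonneg (s : S) : 0 ≤ simpleRoot s := by
  intro r
  by_cases h : r = s
  · subst h; simp [simpleRoot]
  · simp [simpleRoot, h]

lemma simpleRoot_self (s : S) : simpleRoot s s = 1 := by simp [simpleRoot]

lemma simpleRoot_of_ne {s r : S} (h : r ≠ s) : simpleRoot s r = 0 := by simp [simpleRoot, h]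

lemma simpleRoot_injective : Function.Injective (simpleRoot : S → S → ℝ) := by
  intro s t h
  by_contra hst
  have := congrFun h s
  rw [simpleRoot_self, simpleRoot_of_ne hst] at this
  exact one_ne_zero this

/-- Twice the canonical symmetric bilinear form. -/
noncomputable def rootForm (x y : S → ℝ) : ℝ := ∑ s, x s * M.simpleCoroot s y

lemma rootForm_comm (x y : S → ℝ) : M.rootForm x y = M.rootForm y x := by
  simp only [rootForm, simpleCoroot_apply, Finset.mul_sum]
  rw [Finset.sum_comm]
  refine Finset.sum_congr rfl fun s _ => Finset.sum_congr rfl fun t _ => ?_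
  rw [M.symmetric t s]; ring

lemma rootForm_simpleRoot_left (s : S) (x : S → ℝ) :
    M.rootForm (simpleRoot s) x = M.simpleCoroot s x := by
  rw [rootForm, Finset.sum_eq_single s] <;> simp +contextual [simpleRoot]

lemma rootForm_sub_smul_right (x y z : S → ℝ) (a : ℝ) :
    M.rootForm x (y - a • z) = M.rootForm x y - a * M.rootForm x z := by
  simp only [rootForm, map_sub, map_smul, smul_eq_mul, mul_sub, Finset.sum_sub_distrib,
    Finset.mul_sum]
  congr 1
  exact Finset.sum_congr rfl fun s _ => by ring

lemma rootForm_smul_smul (x : S → ℝ) (a b : ℝ) :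
    M.rootForm (a • x) (b • x) = a * b * M.rootForm x x := by
  simp only [rootForm, map_smul, smul_eq_mul, Pi.smul_apply, Finset.mul_sum]
  exact Finset.sum_congr rfl fun s _ => by ring

lemma rootForm_simpleRefl (s : S) (x y : S → ℝ) :
    M.rootForm (M.simpleRefl s x) (M.simpleRefl s y) = M.rootForm x y := by
  rw [simpleRefl_apply M s y, rootForm_sub_smul_right, rootForm_comm M _ y,
    rootForm_comm M _ (simpleRoot s), simpleRefl_apply, rootForm_sub_smul_right,
    rootForm_sub_smul_right, rootForm_comm M y (simpleRoot s), rootForm_simpleRoot_left,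
    rootForm_simpleRoot_left, rootForm_simpleRoot_left, simpleCoroot_self, rootForm_comm M y x]
  ring

/-! ### Dihedral computations -/

/-- The values `U_{k-1}(c)` of the Chebyshev polynomials of the second kind: for `c = cos θ`, the
`k`-th one is `sin (k θ) / sin θ`. They are the coordinates of the roots in rank two. -/
def dihedralCoeff (c : ℝ) : ℕ → ℝ
  | 0 => 0
  | 1 => 1
  | k + 2 => 2 * c * dihedralCoeff c (k + 1) - dihedralCoeff c k

lemma dihedralCoeff_mul_sin (θ : ℝ) (k : ℕ) :
    dihedralCoeff (Real.cos θ) k * Real.sin θ = Real.sin (k * θ) := by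
  induction k using Nat.twoStepInduction with
  | zero => simp [dihedralCoeff]
  | one => simp [dihedralCoeff]
  | more k h0 h1 =>
    rw [dihedralCoeff, sub_mul, mul_assoc, h0, h1]
    have e1 : ((k + 2 : ℕ) : ℝ) * θ = ((k + 1 : ℕ) : ℝ) * θ + θ := by push_cast; ring
    have e2 : (k : ℝ) * θ = ((k + 1 : ℕ) : ℝ) * θ - θ := by push_cast; ring
    rw [e1, e2, Real.sin_add, Real.sin_sub]; ring

lemma dihedralCoeff_one (k : ℕ) : dihedralCoeff 1 k = k := by
  induction k using Nat.twoStepInduction with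
  | zero => simp [dihedralCoeff]
  | one => simp [dihedralCoeff]
  | more k h0 h1 => rw [dihedralCoeff, h0, h1]; push_cast; ring

lemma sin_pi_div_pos {m : ℕ} (hm : 2 ≤ m) : 0 < Real.sin (Real.pi / m) := by
  have : (2 : ℝ) ≤ m := by exact_mod_cast hm
  apply Real.sin_pos_of_pos_of_lt_pi
  · exact div_pos Real.pi_pos (by linarith)
  · exact div_lt_self Real.pi_pos (by linarith)

lemma dihedralCoeff_pos {m k : ℕ} (hm : 2 ≤ m) (h0 : 0 < k) (hk : k < m) :
    0 < dihedralCoeff (Real.cos (Real.pi / m)) k := by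
  have hs := sin_pi_div_pos hm
  have hm' : (0 : ℝ) < m := by exact_mod_cast (by lia : 0 < m)
  have h : 0 < Real.sin (k * (Real.pi / m)) := by
    apply Real.sin_pos_of_pos_of_lt_pi
    · exact mul_pos (by exact_mod_cast h0) (div_pos Real.pi_pos hm')
    · rw [← mul_div_assoc, div_lt_iff₀ hm', mul_comm]
      exact mul_lt_mul_of_pos_left (by exact_mod_cast hk) Real.pi_pos
  rw [← dihedralCoeff_mul_sin] at h
  exact (pos_iff_pos_of_mul_pos h).mpr hs

lemma dihedralCoeff_self {m : ℕ} (hm : 2 ≤ m) :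
    dihedralCoeff (Real.cos (Real.pi / m)) m = 0 := by
  have hs := sin_pi_div_pos hm
  have hm' : (m : ℝ) ≠ 0 := by exact_mod_cast (by lia : m ≠ 0)
  have h := dihedralCoeff_mul_sin (Real.pi / m) m
  rw [mul_div_cancel₀ _ hm', Real.sin_pi] at h
  exact (mul_eq_zero.mp h).resolve_right hs.ne'

lemma dihedralCoeff_self_add_one {m : ℕ} (hm : 2 ≤ m) :
    dihedralCoeff (Real.cos (Real.pi / m)) (m + 1) = -1 := by
  have hs := sin_pi_div_pos hm
  have hm' : (m : ℝ) ≠ 0 := by exact_mod_cast (by lia : m ≠ 0)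
  have h := dihedralCoeff_mul_sin (Real.pi / m) (m + 1)
  push_cast at h
  rw [add_mul, mul_div_cancel₀ _ hm', one_mul, add_comm Real.pi, Real.sin_add_pi] at h
  exact mul_right_cancel₀ hs.ne' (by rw [h]; ring)

lemma dihedralCoeff_nonneg {m k : ℕ} (hm : m ≠ 1) (hk : m ≠ 0 → k ≤ m) :
    0 ≤ dihedralCoeff (Real.cos (Real.pi / m)) k := by
  rcases Nat.eq_zero_or_pos m with rfl | hm0
  · simp [dihedralCoeff_one]
  · have hm2 : 2 ≤ m := by lia
    rcases Nat.eq_zero_or_pos k with rfl | hk0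
    · simp [dihedralCoeff]
    · rcases (hk hm0.ne').lt_or_eq with h | rfl
      · exact (dihedralCoeff_pos hm2 hk0 h).le
      · exact (dihedralCoeff_self hm2).ge

/-- The `k`-th letter, counted from the right and starting with `0`, of the alternating words
ending with `t`. -/
def altLetter (s t : S) (k : ℕ) : S := if Even k then t else s

lemma altLetter_add_two (s t : S) (k : ℕ) : altLetter s t (k + 2) = altLetter s t k := by
  simp [altLetter, Nat.even_add]

lemma altLetter_swap (s t : S) (k : ℕ) : altLetter t s k = altLetter s t (k + 1) := by
  by_cases h : Even k <;> simp [altLetter, Nat.even_add_one, h]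

lemma altLetter_eq_or (s t : S) (k : ℕ) :
    altLetter s t k = t ∧ altLetter s t (k + 1) = s ∨
      altLetter s t k = s ∧ altLetter s t (k + 1) = t := by
  by_cases h : Even k <;> simp [altLetter, Nat.even_add_one, h]

lemma altLetter_ne {s t : S} (hst : s ≠ t) (k : ℕ) :
    altLetter s t (k + 1) ≠ altLetter s t k := by
  rcases altLetter_eq_or s t k with ⟨h1, h2⟩ | ⟨h1, h2⟩ <;> rw [h1, h2]
  exacts [hst, hst.symm]

lemma alternatingWord_succ_eq_cons (s t : S) (k : ℕ) :
    alternatingWord s t (k + 1) = altLetter s t k :: alternatingWord s t k :=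
  alternatingWord_succ' s t k

/-- The product of a word in the geometric representation. -/
noncomputable def wordRefl (l : List S) : (S → ℝ) ≃ₗ[ℝ] (S → ℝ) := (l.map M.simpleRefl).prod

lemma wordRefl_cons (s : S) (l : List S) :
    M.wordRefl (s :: l) = M.simpleRefl s * M.wordRefl l := by simp [wordRefl]

lemma wordRefl_append (l l' : List S) : M.wordRefl (l ++ l') = M.wordRefl l * M.wordRefl l' := by
  simp [wordRefl]

lemma wordRefl_singleton (s : S) : M.wordRefl [s] = M.simpleRefl s := by simp [wordRefl]

lemma wordRefl_alt_succ (s t : S) (k : ℕ) :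
    M.wordRefl (alternatingWord s t (k + 1)) =
      M.simpleRefl (altLetter s t k) * M.wordRefl (alternatingWord s t k) := by
  rw [alternatingWord_succ_eq_cons, wordRefl_cons]

lemma wordRefl_alt_succ_right (s t : S) (k : ℕ) :
    M.wordRefl (alternatingWord s t (k + 1)) =
      M.wordRefl (alternatingWord t s k) * M.simpleRefl t := by
  rw [alternatingWord_succ, List.concat_eq_append, wordRefl_append, wordRefl_singleton]

lemma simpleRefl_combination {s t : S} (a b : ℝ) :
    M.simpleRefl s (a • simpleRoot t + b • simpleRoot s) =
      a • simpleRoot t + (2 * Real.cos (Real.pi / M s t) * a - b) • simpleRoot s := by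
  rw [simpleRefl_apply, map_add, map_smul, map_smul, simpleCoroot_self, simpleCoroot_simpleRoot]
  module

lemma cos_altLetter (s t : S) (k : ℕ) :
    Real.cos (Real.pi / M (altLetter s t k) (altLetter s t (k + 1))) =
      Real.cos (Real.pi / M s t) := by
  rcases altLetter_eq_or s t k with ⟨h1, h2⟩ | ⟨h1, h2⟩ <;> rw [h1, h2]
  rw [M.symmetric]

lemma simpleRefl_dihedralCoeff (s t : S) (j k : ℕ) :
    M.simpleRefl (altLetter s t k)
      (dihedralCoeff (Real.cos (Real.pi / M s t)) (j + 1) • simpleRoot (altLetter s t (k + 1)) +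
        dihedralCoeff (Real.cos (Real.pi / M s t)) j • simpleRoot (altLetter s t k)) =
      dihedralCoeff (Real.cos (Real.pi / M s t)) (j + 2) • simpleRoot (altLetter s t (k + 2)) +
        dihedralCoeff (Real.cos (Real.pi / M s t)) (j + 1) • simpleRoot (altLetter s t (k + 1)) := by
  rw [simpleRefl_combination, cos_altLetter, altLetter_add_two, dihedralCoeff, add_comm]

lemma wordRefl_alt_simpleRoot_left (s t : S) (k : ℕ) :
    M.wordRefl (alternatingWord s t k) (simpleRoot s) =
      dihedralCoeff (Real.cos (Real.pi / M s t)) (k + 1) • simpleRoot (altLetter s t (k + 1)) +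
        dihedralCoeff (Real.cos (Real.pi / M s t)) k • simpleRoot (altLetter s t k) := by
  induction k with
  | zero => simp [alternatingWord, wordRefl, dihedralCoeff, altLetter]
  | succ k ih => rw [wordRefl_alt_succ, LinearEquiv.mul_apply, ih, simpleRefl_dihedralCoeff]

lemma wordRefl_alt_simpleRoot_right (s t : S) (k : ℕ) :
    M.wordRefl (alternatingWord s t (k + 1)) (simpleRoot t) =
      -(dihedralCoeff (Real.cos (Real.pi / M s t)) (k + 1) • simpleRoot (altLetter s t k) +
        dihedralCoeff (Real.cos (Real.pi / M s t)) k • simpleRoot (altLetter s t (k + 1))) := by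
  rw [wordRefl_alt_succ_right, LinearEquiv.mul_apply, simpleRefl_simpleRoot_self, map_neg,
    wordRefl_alt_simpleRoot_left, altLetter_swap s t, altLetter_swap s t, altLetter_add_two,
    M.symmetric t s]

lemma two_le_of_ne {s t : S} (hst : s ≠ t) (hm : M s t ≠ 0) : 2 ≤ M s t := by
  have := M.off_diagonal s t hst
  lia

lemma wordRefl_longest_simpleRoot_left {s t : S} (hst : s ≠ t) (hm : M s t ≠ 0) :
    M.wordRefl (alternatingWord s t (M s t)) (simpleRoot s) =
      -simpleRoot (altLetter s t (M s t + 1)) := by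
  have h2 := M.two_le_of_ne hst hm
  rw [wordRefl_alt_simpleRoot_left, dihedralCoeff_self h2, dihedralCoeff_self_add_one h2]
  simp

lemma wordRefl_longest_simpleRoot_right {s t : S} (hst : s ≠ t) (hm : M s t ≠ 0) :
    M.wordRefl (alternatingWord s t (M s t)) (simpleRoot t) =
      -simpleRoot (altLetter s t (M s t)) := by
  have h2 := M.two_le_of_ne hst hm
  obtain ⟨k, hk⟩ : ∃ k, M s t = k + 1 := ⟨M s t - 1, by lia⟩
  have h1 := dihedralCoeff_self_add_one h2
  have h0 := dihedralCoeff_self h2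
  have hk1 : dihedralCoeff (Real.cos (Real.pi / M s t)) k = 1 := by
    rw [hk, dihedralCoeff, ← hk, h0] at h1
    linarith
  have := M.wordRefl_alt_simpleRoot_right s t k
  rw [← hk, h0, hk1] at this
  rw [this]
  simp

lemma wordRefl_alt_of_orthogonal {s t : S} {x : S → ℝ} (hs : M.simpleCoroot s x = 0)
    (ht : M.simpleCoroot t x = 0) (k : ℕ) : M.wordRefl (alternatingWord s t k) x = x := by
  induction k with
  | zero => rfl
  | succ k ih =>
    rw [wordRefl_alt_succ, LinearEquiv.mul_apply, ih, simpleRefl_apply]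
    rcases altLetter_eq_or s t k with ⟨h1, -⟩ | ⟨h1, -⟩ <;> simp [h1, hs, ht]

/-- The geometric representation satisfies the braid relations. -/
lemma wordRefl_braid {s t : S} (hst : s ≠ t) (hm : M s t ≠ 0) :
    M.wordRefl (alternatingWord s t (M s t)) = M.wordRefl (alternatingWord t s (M s t)) := by
  have h2 := M.two_le_of_ne hst hm
  ext1 x
  set c := Real.cos (Real.pi / M s t) with hc
  -- The form restricted to the span of the two roots is nondegenerate.
  have hdet : 1 - c ^ 2 ≠ 0 := by
    have := sin_pi_div_pos h2
    have h := Real.sin_sq_add_cos_sq (Real.pi / M s t)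
    rw [← hc] at h
    nlinarith
  set p := (M.simpleCoroot s x + c * M.simpleCoroot t x) / (2 * (1 - c ^ 2)) with hp
  set q := (M.simpleCoroot t x + c * M.simpleCoroot s x) / (2 * (1 - c ^ 2)) with hq
  set y := x - (p • simpleRoot s + q • simpleRoot t) with hy
  have hys : M.simpleCoroot s y = 0 := by
    simp only [hy, map_sub, map_add, map_smul, simpleCoroot_self, simpleCoroot_simpleRoot, ← hc,
      smul_eq_mul, hp, hq]
    field_simp
    ring
  have hyt : M.simpleCoroot t y = 0 := by
    simp only [hy, map_sub, map_add, map_smul, simpleCoroot_self, simpleCoroot_simpleRoot,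
      M.symmetric t s, ← hc, smul_eq_mul, hp, hq]
    field_simp
    ring
  have hx : x = y + (p • simpleRoot s + q • simpleRoot t) := by rw [hy]; abel
  have hts : M t s ≠ 0 := by rwa [M.symmetric]
  have e1 := M.wordRefl_longest_simpleRoot_right hst.symm hts
  have e2 := M.wordRefl_longest_simpleRoot_left hst.symm hts
  rw [M.symmetric t s, altLetter_swap] at e1 e2
  rw [altLetter_add_two] at e2
  rw [hx]
  simp only [map_add, map_smul, wordRefl_alt_of_orthogonal M hys hyt,
    wordRefl_alt_of_orthogonal M hyt hys, wordRefl_longest_simpleRoot_left M hst hm,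
    wordRefl_longest_simpleRoot_right M hst hm, e1, e2]

/-! ### Words in the geometric representation and positivity of roots -/

/-- `u` is the product of a word of length `n` in the simple reflections indexed by `J`. -/
def HasWord (J : Set S) (n : ℕ) (u : (S → ℝ) ≃ₗ[ℝ] (S → ℝ)) : Prop :=
  ∃ l : List S, (∀ x ∈ l, x ∈ J) ∧ l.length = n ∧ M.wordRefl l = u

variable {M} in
lemma HasWord.mul {J : Set S} {m n : ℕ} {u v : (S → ℝ) ≃ₗ[ℝ] (S → ℝ)} (hu : M.HasWord J m u)
    (hv : M.HasWord J n v) : M.HasWord J (m + n) (u * v) := by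
  obtain ⟨l, hl, rfl, rfl⟩ := hu
  obtain ⟨l', hl', rfl, rfl⟩ := hv
  exact ⟨l ++ l', by simpa [or_imp, forall_and] using ⟨hl, hl'⟩, by simp,
    M.wordRefl_append l l'⟩

lemma hasWord_simpleRefl {J : Set S} {s : S} (hs : s ∈ J) : M.HasWord J 1 (M.simpleRefl s) :=
  ⟨[s], by simpa using hs, rfl, M.wordRefl_singleton s⟩

lemma hasWord_one (J : Set S) : M.HasWord J 0 1 := ⟨[], by simp, rfl, rfl⟩

variable {M} in
lemma HasWord.inv {J : Set S} {n : ℕ} {u : (S → ℝ) ≃ₗ[ℝ] (S → ℝ)} (hu : M.HasWord J n u) :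
    M.HasWord J n u⁻¹ := by
  obtain ⟨l, hl, rfl, rfl⟩ := hu
  refine ⟨l.reverse, by simpa using hl, by simp, ?_⟩
  rw [wordRefl, wordRefl, List.prod_inv_reverse, List.map_reverse, List.map_map]
  rfl

variable {M} in
lemma HasWord.mono {I J : Set S} (h : I ⊆ J) {n : ℕ} {u : (S → ℝ) ≃ₗ[ℝ] (S → ℝ)}
    (hu : M.HasWord I n u) : M.HasWord J n u := by
  obtain ⟨l, hl, rfl, rfl⟩ := hu
  exact ⟨l, fun x hx => h (hl x hx), rfl, rfl⟩

/-- A word in two letters is alternating or can be shortened. -/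
lemma alternating_or_shorten (s t : S) (l : List S) (hl : ∀ x ∈ l, x ∈ ({s, t} : Set S)) :
    l = alternatingWord s t l.length ∨ l = alternatingWord t s l.length ∨
      ∃ m, m + 2 ≤ l.length ∧ M.HasWord {s, t} m (M.wordRefl l) := by
  induction l with
  | nil => exact Or.inl rfl
  | cons r l ih =>
    have hr : r ∈ ({s, t} : Set S) := hl r (by simp)
    have hl' : ∀ x ∈ l, x ∈ ({s, t} : Set S) := fun x hx => hl x (by simp [hx])
    have key : ∀ a b : S, l = alternatingWord a b l.length → (r = a ∨ r = b) →
        r :: l = alternatingWord a b (l.length + 1) ∨ r :: l = alternatingWord b a (l.length + 1) ∨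
        ∃ m, m + 2 ≤ l.length + 1 ∧ M.HasWord {s, t} m (M.wordRefl (r :: l)) := by
      intro a b h hab
      rcases Nat.eq_zero_or_pos l.length with h0 | h0
      · obtain rfl := List.length_eq_zero_iff.mp h0
        rcases hab with rfl | rfl
        · exact Or.inr (Or.inl rfl)
        · exact Or.inl rfl
      obtain ⟨k, hk⟩ : ∃ k, l.length = k + 1 := ⟨l.length - 1, by lia⟩
      by_cases hrk : r = altLetter a b (k + 1)
      · left
        rw [hk, alternatingWord_succ_eq_cons, ← hrk, ← hk, ← h]
      · right; right
        have hrk' : r = altLetter a b k := by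
          rcases altLetter_eq_or a b k with ⟨h1, h2⟩ | ⟨h1, h2⟩ <;> rw [h1] <;>
            rw [h2] at hrk <;> tauto
        rw [hk, alternatingWord_succ_eq_cons, ← hrk'] at h
        refine ⟨k, by lia, alternatingWord a b k, fun x hx => hl' x ?_, by simp, ?_⟩
        · rw [h]; simp [hx]
        · rw [h, wordRefl_cons, wordRefl_cons, ← mul_assoc, simpleRefl_mul_self, one_mul]
    rcases ih hl' with h | h | ⟨m, hm, hw⟩
    · exact key s t h hr
    · exact (key t s h hr.symm).elim (fun h => Or.inr (Or.inl h))
        fun h => h.elim Or.inl fun h => Or.inr (Or.inr h)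
    · right; right
      refine ⟨1 + m, by simp; lia, ?_⟩
      rw [wordRefl_cons]
      exact (M.hasWord_simpleRefl hr).mul hw

lemma exists_alternatingWord_add (s t : S) (m j : ℕ) :
    ∃ l : List S, (∀ x ∈ l, x ∈ ({s, t} : Set S)) ∧ l.length = j ∧
      alternatingWord s t (m + j) = l ++ alternatingWord s t m := by
  induction j with
  | zero => exact ⟨[], by simp, rfl, rfl⟩
  | succ j ih =>
    obtain ⟨l, hl, hlen, h⟩ := ih
    refine ⟨altLetter s t (m + j) :: l, ?_, by simp [hlen], ?_⟩
    · intro x hx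
      rcases List.mem_cons.mp hx with rfl | hx
      · rcases altLetter_eq_or s t (m + j) with ⟨h1, -⟩ | ⟨h1, -⟩ <;> simp [h1]
      · exact hl x hx
    · rw [← add_assoc, alternatingWord_succ_eq_cons, h, List.cons_append]

lemma hasWord_alternatingWord (s t : S) (k : ℕ) :
    M.HasWord {s, t} k (M.wordRefl (alternatingWord s t k)) := by
  obtain ⟨l, hl, hlen, h⟩ := exists_alternatingWord_add s t 0 k
  rw [Nat.zero_add] at h
  rw [h]
  exact ⟨l, hl, hlen, by simp [alternatingWord]⟩

/-- The rank two case of the positivity theorem. -/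
lemma dihedral_nonneg {s t : S} (hst : s ≠ t) (l : List S)
    (hl : ∀ x ∈ l, x ∈ ({s, t} : Set S))
    (hmin : ∀ m < l.length, ¬ M.HasWord {s, t} m (M.wordRefl l * M.simpleRefl s)) :
    ∃ a b : ℝ, 0 ≤ a ∧ 0 ≤ b ∧ M.wordRefl l (simpleRoot s) =
      a • simpleRoot s + b • simpleRoot t := by
  have hs : s ∈ ({s, t} : Set S) := by simp
  rcases M.alternating_or_shorten s t l hl with h | h | ⟨m, hm, hw⟩
  · set k := l.length
    have hk : M s t ≠ 0 → k + 1 ≤ M s t := by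
      intro h0
      by_contra hlt
      have h2 := M.two_le_of_ne hst h0
      obtain ⟨l', hl', hlen, h'⟩ := exists_alternatingWord_add s t (M s t) (k - M s t)
      rw [Nat.add_sub_cancel' (by lia)] at h'
      obtain ⟨m, hm⟩ : ∃ m, M s t = m + 1 := ⟨M s t - 1, by lia⟩
      apply hmin ((k - M s t) + m) (by lia)
      rw [h, h', wordRefl_append, M.wordRefl_braid hst h0]
      nth_rw 2 [hm]
      rw [wordRefl_alt_succ_right, mul_assoc, mul_assoc, simpleRefl_mul_self, mul_one]
      exact HasWord.mul ⟨l', hl', hlen, rfl⟩ (M.hasWord_alternatingWord s t m)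
    have h1 : M s t ≠ 1 := M.off_diagonal s t hst
    have e := M.wordRefl_alt_simpleRoot_left s t k
    rw [← h] at e
    have ha := dihedralCoeff_nonneg h1 hk
    have hb := dihedralCoeff_nonneg h1 fun h0 => (Nat.le_succ k).trans (hk h0)
    rcases altLetter_eq_or s t k with ⟨h1, h2⟩ | ⟨h1, h2⟩
    · exact ⟨_, _, ha, hb, by rw [e, h1, h2]⟩
    · exact ⟨_, _, hb, ha, by rw [e, h1, h2, add_comm]⟩
  · rcases Nat.eq_zero_or_pos l.length with h0 | h0
    · obtain rfl := List.length_eq_zero_iff.mp h0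
      exact ⟨1, 0, zero_le_one, le_rfl, by simp [wordRefl]⟩
    obtain ⟨k, hk⟩ : ∃ k, l.length = k + 1 := ⟨l.length - 1, by lia⟩
    refine (hmin k (by lia) ?_).elim
    rw [h, hk, wordRefl_alt_succ_right, mul_assoc, simpleRefl_mul_self, mul_one]
    exact M.hasWord_alternatingWord s t k
  · exact (hmin (m + 1) (by lia) (hw.mul (M.hasWord_simpleRefl hs))).elim

/-- If multiplying `u` on the right by the reflection in `s` does not shorten it, then `u` sends
the simple root of `s` to a positive root. Lengths are taken with respect to words in `J`. -/
theorem nonneg_of_not_shorter (J : Set S) (n : ℕ) :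
    ∀ (u : (S → ℝ) ≃ₗ[ℝ] (S → ℝ)) (s : S), s ∈ J → M.HasWord J n u →
      (∀ m < n, ¬ M.HasWord J m (u * M.simpleRefl s)) → 0 ≤ u (simpleRoot s) := by
  classical
  induction n using Nat.strong_induction_on with
  | _ n ih =>
    intro u s hs hu hmin
    rcases Nat.eq_zero_or_pos n with rfl | hn
    · obtain ⟨l, -, hlen, rfl⟩ := hu
      obtain rfl := List.length_eq_zero_iff.mp hlen
      exact simpleRoot_nonneg s
    obtain ⟨l, hl, hlen, hlu⟩ := hu
    obtain ⟨l, t, rfl⟩ : ∃ l' t, l = l' ++ [t] := by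
      rcases List.eq_nil_or_concat' l with rfl | ⟨l', t, h⟩
      · simp at hlen; lia
      · exact ⟨l', t, h⟩
    have ht : t ∈ J := hl t (by simp)
    have hlJ : ∀ x ∈ l, x ∈ J := fun x hx => hl x (by simp [hx])
    have hlen' : l.length + 1 = n := by simpa using hlen
    rw [wordRefl_append, wordRefl_singleton] at hlu
    have hst : s ≠ t := by
      rintro rfl
      refine hmin l.length (by lia) ⟨l, hlJ, rfl, ?_⟩
      rw [← hlu, mul_assoc, simpleRefl_mul_self, mul_one]
    have hstJ : ({s, t} : Set S) ⊆ J := by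
      rintro x (rfl | rfl)
      exacts [hs, ht]
    -- Split off a longest possible dihedral factor on the right.
    have hex : ∃ p, ∃ v z, M.HasWord J p v ∧ (∀ x ∈ z, x ∈ ({s, t} : Set S)) ∧
        p + z.length ≤ n ∧ u = v * M.wordRefl z :=
      ⟨l.length, M.wordRefl l, [t], ⟨l, hlJ, rfl, rfl⟩, by simp, by simp; lia,
        by rw [wordRefl_singleton, hlu]⟩
    obtain ⟨v, z, hv, hz, hlen, huv⟩ := Nat.find_spec hex
    set p := Nat.find hex with hp
    have hpn : p < n := by
      have : p ≤ l.length := Nat.find_min' hex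
        ⟨M.wordRefl l, [t], ⟨l, hlJ, rfl, rfl⟩, by simp, by simp; lia,
          by rw [wordRefl_singleton, hlu]⟩
      lia
    have hvr : ∀ r ∈ ({s, t} : Set S), 0 ≤ v (simpleRoot r) := by
      intro r hr
      refine ih p hpn v r (hstJ hr) hv fun m hm hw => Nat.find_min hex hm ?_
      refine ⟨v * M.simpleRefl r, r :: z, hw, ?_, by simp; lia, ?_⟩
      · intro x hx
        rcases List.mem_cons.mp hx with rfl | hx
        exacts [hr, hz x hx]
      · rw [wordRefl_cons, huv, ← mul_assoc, mul_assoc v, simpleRefl_mul_self, mul_one]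
    obtain ⟨a, b, ha, hb, hab⟩ := M.dihedral_nonneg hst z hz fun m hm hw => by
      refine hmin (p + m) (by lia) ?_
      rw [huv, mul_assoc]
      exact hv.mul (hw.mono hstJ)
    rw [huv, LinearEquiv.mul_apply, hab, map_add, map_smul, map_smul]
    exact add_nonneg (smul_nonneg ha (hvr s (by simp))) (smul_nonneg hb (hvr t (by simp)))

/-- The group generated by the simple reflections indexed by `J`. -/
def reflGroup (J : Set S) : Subgroup ((S → ℝ) ≃ₗ[ℝ] (S → ℝ)) :=
  Subgroup.closure (M.simpleRefl '' J)

lemma simpleRefl_mem {J : Set S} {s : S} (hs : s ∈ J) : M.simpleRefl s ∈ M.reflGroup J :=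
  Subgroup.subset_closure ⟨s, hs, rfl⟩

lemma exists_hasWord {J : Set S} {u : (S → ℝ) ≃ₗ[ℝ] (S → ℝ)} (hu : u ∈ M.reflGroup J) :
    ∃ n, M.HasWord J n u := by
  induction hu using Subgroup.closure_induction with
  | mem x hx =>
    obtain ⟨s, hs, rfl⟩ := hx
    exact ⟨1, M.hasWord_simpleRefl hs⟩
  | one => exact ⟨0, M.hasWord_one J⟩
  | mul x y _ _ hx hy =>
    obtain ⟨m, hm⟩ := hx
    obtain ⟨n, hn⟩ := hy
    exact ⟨m + n, hm.mul hn⟩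
  | inv x _ hx =>
    obtain ⟨m, hm⟩ := hx
    exact ⟨m, hm.inv⟩

variable {M} in
lemma HasWord.mem_reflGroup {J : Set S} {n : ℕ} {u : (S → ℝ) ≃ₗ[ℝ] (S → ℝ)}
    (hu : M.HasWord J n u) : u ∈ M.reflGroup J := by
  obtain ⟨l, hl, -, rfl⟩ := hu
  refine Subgroup.list_prod_mem _ fun x hx => ?_
  obtain ⟨s, hs, rfl⟩ := List.mem_map.mp hx
  exact M.simpleRefl_mem (hl s hs)

lemma exists_minimal_hasWord {J : Set S} {u : (S → ℝ) ≃ₗ[ℝ] (S → ℝ)} (hu : u ∈ M.reflGroup J) :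
    ∃ n, M.HasWord J n u ∧ ∀ m < n, ¬ M.HasWord J m u := by
  classical
  exact ⟨Nat.find (M.exists_hasWord hu), Nat.find_spec (M.exists_hasWord hu),
    fun _ => Nat.find_min (M.exists_hasWord hu)⟩

/-- Every root is positive or negative. -/
theorem nonneg_or_nonpos {u : (S → ℝ) ≃ₗ[ℝ] (S → ℝ)} (hu : u ∈ M.reflGroup Set.univ) (s : S) :
    0 ≤ u (simpleRoot s) ∨ u (simpleRoot s) ≤ 0 := by
  obtain ⟨n, hn, hmin⟩ := M.exists_minimal_hasWord hu
  by_cases h : ∃ m < n, M.HasWord Set.univ m (u * M.simpleRefl s)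
  · obtain ⟨m, hm, hw⟩ := h
    obtain ⟨k, hk, hmin'⟩ := M.exists_minimal_hasWord hw.mem_reflGroup
    have hkm : k ≤ m := not_lt.mp fun h => hmin' m h hw
    right
    have := M.nonneg_of_not_shorter Set.univ k _ s trivial hk fun j hj hw' => by
      rw [mul_assoc, simpleRefl_mul_self, mul_one] at hw'
      exact hmin j (by lia) hw'
    rw [LinearEquiv.mul_apply, simpleRefl_simpleRoot_self, map_neg] at this
    exact neg_nonneg.mp this
  · push Not at h
    exact Or.inl (M.nonneg_of_not_shorter Set.univ n u s trivial hn h)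

lemma rootForm_reflGroup {u : (S → ℝ) ≃ₗ[ℝ] (S → ℝ)} (hu : u ∈ M.reflGroup Set.univ)
    (x y : S → ℝ) : M.rootForm (u x) (u y) = M.rootForm x y := by
  obtain ⟨n, l, -, -, rfl⟩ := M.exists_hasWord hu
  induction l with
  | nil => rfl
  | cons r l ih =>
    rw [wordRefl_cons, LinearEquiv.mul_apply, LinearEquiv.mul_apply, rootForm_simpleRefl]
    exact ih (HasWord.mem_reflGroup ⟨l, by simp, rfl, rfl⟩)

lemma reflGroup_apply_of_notMem {J : Set S} {u : (S → ℝ) ≃ₗ[ℝ] (S → ℝ)} (hu : u ∈ M.reflGroup J)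
    {r : S} (hr : r ∉ J) (x : S → ℝ) : u x r = x r := by
  obtain ⟨n, l, hl, -, rfl⟩ := M.exists_hasWord hu
  clear hu
  induction l with
  | nil => rfl
  | cons s l ih =>
    rw [wordRefl_cons, LinearEquiv.mul_apply, simpleRefl_apply_of_ne]
    · exact ih fun y hy => hl y (by simp [hy])
    · rintro rfl
      exact hr (hl r (by simp))

lemma reflGroup_mono {I J : Set S} (h : I ⊆ J) : M.reflGroup I ≤ M.reflGroup J :=
  Subgroup.closure_mono (Set.image_mono h)

lemma reflGroup_apply_ne_zero (u : (S → ℝ) ≃ₗ[ℝ] (S → ℝ)) (s : S) : u (simpleRoot s) ≠ 0 := by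
  rw [Ne, LinearEquiv.map_eq_zero_iff]
  intro h
  have := congrFun h s
  rw [simpleRoot_self] at this
  exact one_ne_zero this

/-- A positive root all of whose other coordinates vanish is simple. -/
lemma eq_simpleRoot_of_forall_ne {u : (S → ℝ) ≃ₗ[ℝ] (S → ℝ)} (hu : u ∈ M.reflGroup Set.univ)
    {s t : S} (hpos : 0 ≤ u (simpleRoot t)) (h : ∀ r ≠ s, u (simpleRoot t) r = 0) :
    u (simpleRoot t) = simpleRoot s := by
  have e : u (simpleRoot t) = u (simpleRoot t) s • simpleRoot s := by
    ext r
    by_cases hr : r = s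
    · subst hr; simp [simpleRoot_self]
    · simp [h r hr, simpleRoot_of_ne hr]
  have h2 := M.rootForm_reflGroup hu (simpleRoot t) (simpleRoot t)
  rw [e, rootForm_smul_smul, rootForm_simpleRoot_left, rootForm_simpleRoot_left,
    simpleCoroot_self, simpleCoroot_self] at h2
  have h3 : 0 ≤ u (simpleRoot t) s := hpos s
  have h4 : u (simpleRoot t) s = 1 := by nlinarith
  rw [e, h4, one_smul]

/-- A simple reflection makes only its own simple root negative. -/
lemma simpleRefl_nonneg {u : (S → ℝ) ≃ₗ[ℝ] (S → ℝ)} (hu : u ∈ M.reflGroup Set.univ)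
    {s t : S} (hpos : 0 ≤ u (simpleRoot t)) (h : u (simpleRoot t) ≠ simpleRoot s) :
    0 ≤ M.simpleRefl s (u (simpleRoot t)) := by
  obtain ⟨r, hr, hr0⟩ : ∃ r ≠ s, u (simpleRoot t) r ≠ 0 := by
    by_contra! hcon
    exact h (M.eq_simpleRoot_of_forall_ne hu hpos hcon)
  rcases M.nonneg_or_nonpos (mul_mem (M.simpleRefl_mem (Set.mem_univ s)) hu) t with h1 | h1
  · exact h1
  · have h2 := h1 r
    rw [LinearEquiv.mul_apply, simpleRefl_apply_of_ne M hr] at h2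
    exact (hr0 (le_antisymm h2 (hpos r))).elim

/-! ### Fundamental coweights and walks in the Dynkin diagram -/

lemma rootForm_add_left (x y z : S → ℝ) :
    M.rootForm (x + y) z = M.rootForm x z + M.rootForm y z := by
  simp [rootForm, add_mul, Finset.sum_add_distrib]

/-- The coordinate indexed by `c` is a dominant linear form: moving it by `u` in the parabolic
subgroup of `J` subtracts a nonnegative combination of coroots indexed by `J`. -/
lemma exists_coordinate_eq_sub {J : Set S} (c : S) {u : (S → ℝ) ≃ₗ[ℝ] (S → ℝ)}
    (hu : u ∈ M.reflGroup J) :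
    ∃ κ : S → ℝ, 0 ≤ κ ∧ (∀ s ∉ J, κ s = 0) ∧ ∀ x, u x c = x c - M.rootForm κ x := by
  obtain ⟨n, hn, hmin⟩ := M.exists_minimal_hasWord hu
  clear hu
  induction n generalizing u with
  | zero =>
    obtain ⟨l, -, hlen, rfl⟩ := hn
    obtain rfl := List.length_eq_zero_iff.mp hlen
    exact ⟨0, le_rfl, by simp, fun x => by simp [rootForm, wordRefl]⟩
  | succ n ih =>
    obtain ⟨l, hl, hlen, rfl⟩ := hn
    obtain ⟨s, l, rfl⟩ := List.exists_cons_of_length_eq_add_one hlen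
    have hs : s ∈ J := hl s (by simp)
    have hw : M.HasWord J n (M.wordRefl l) :=
      ⟨l, fun x hx => hl x (by simp [hx]), by simpa using hlen, rfl⟩
    rw [wordRefl_cons] at hmin ⊢
    obtain ⟨κ, h0, hJ, hκ⟩ := ih hw fun m hm hm' =>
      hmin (1 + m) (by lia) ((M.hasWord_simpleRefl hs).mul hm')
    by_cases hsc : s = c
    · subst hsc
      set v := M.wordRefl l with hv
      have hvW : v ∈ M.reflGroup Set.univ := M.reflGroup_mono (Set.subset_univ J) hw.mem_reflGroup
      refine ⟨κ + v⁻¹ (simpleRoot s), add_nonneg h0 ?_, fun r hr => ?_, fun x => ?_⟩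
      · refine M.nonneg_of_not_shorter J n _ s hs hw.inv fun m hm hm' => ?_
        refine hmin m (by lia) ?_
        have := hm'.inv
        rwa [mul_inv_rev, inv_inv, simpleRefl, Module.reflection_inv] at this
      · rw [Pi.add_apply, hJ r hr, M.reflGroup_apply_of_notMem (inv_mem hw.mem_reflGroup) hr,
          simpleRoot_of_ne (by rintro rfl; exact hr hs), add_zero]
      · have e : M.simpleCoroot s (v x) = M.rootForm (v⁻¹ (simpleRoot s)) x := by
          rw [← rootForm_simpleRoot_left, ← M.rootForm_reflGroup (inv_mem hvW)]
          congr 1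
          exact v.symm_apply_apply x
        rw [LinearEquiv.mul_apply, simpleRefl_apply, Pi.sub_apply, hκ, Pi.smul_apply,
          simpleRoot_self, e, rootForm_add_left, smul_eq_mul]
        ring
    · refine ⟨κ, h0, hJ, fun x => ?_⟩
      rw [LinearEquiv.mul_apply, simpleRefl_apply_of_ne M (Ne.symm hsc), hκ]

lemma simpleCoroot_simpleRoot_nonpos {s t : S} (hst : s ≠ t) :
    M.simpleCoroot s (simpleRoot t) ≤ 0 := by
  rw [simpleCoroot_simpleRoot]
  have h := dihedralCoeff_nonneg (m := M s t) (k := 2) (M.off_diagonal s t hst)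
    (M.two_le_of_ne hst)
  simp only [dihedralCoeff] at h
  linarith

lemma simpleCoroot_simpleRoot_neg {s t : S} (hst : (dynkinDiagram M).Adj s t) :
    M.simpleCoroot s (simpleRoot t) < 0 := by
  rw [simpleCoroot_simpleRoot]
  rcases eq_or_ne (M s t) 0 with h0 | h0
  · simp [h0]
  · have h2 := M.two_le_of_ne hst.1 h0
    have h3 := hst.2
    have h := dihedralCoeff_pos (k := 2) h2 (by lia) (by lia)
    simp only [dihedralCoeff] at h
    linarith

/-- If `u` lies in the parabolic subgroup omitting `b`, then along every walk from `c` to `b`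
in the Dynkin diagram, `u` maps some simple root to a root involving `c`. -/
theorem exists_mem_support_apply_ne_zero {c b : S} (w : (dynkinDiagram M).Walk c b)
    {u : (S → ℝ) ≃ₗ[ℝ] (S → ℝ)} (hu : u ∈ M.reflGroup {b}ᶜ) :
    ∃ r ∈ w.support, u (simpleRoot r) c ≠ 0 := by
  obtain ⟨κ, h0, hJ, hκ⟩ := M.exists_coordinate_eq_sub c hu
  have hb : κ b = 0 := hJ b (by simp)
  -- Vanishing of `κ` at `p` makes all summands of the coordinate of `u (simpleRoot p)` nonnegative.
  have step : ∀ p, κ p = 0 → u (simpleRoot p) c = 0 →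
      p ≠ c ∧ ∀ s, (dynkinDiagram M).Adj s p → κ s = 0 := by
    intro p hp hup
    have hterm : ∀ s, κ s * M.simpleCoroot s (simpleRoot p) ≤ 0 := by
      intro s
      rcases eq_or_ne s p with rfl | hsp
      · simp [hp]
      · exact mul_nonpos_of_nonneg_of_nonpos (h0 s) (M.simpleCoroot_simpleRoot_nonpos hsp)
    have hsum : M.rootForm κ (simpleRoot p) ≤ 0 := Finset.sum_nonpos fun s _ => hterm s
    have hpc : (0 : ℝ) ≤ simpleRoot p c := simpleRoot_nonneg p c
    have h := hκ (simpleRoot p)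
    rw [hup] at h
    have h1 : simpleRoot p c = 0 := by linarith
    have h2 : M.rootForm κ (simpleRoot p) = 0 := by linarith
    refine ⟨?_, fun s hs => ?_⟩
    · rintro rfl
      rw [simpleRoot_self] at h1
      exact one_ne_zero h1
    · have := (Finset.sum_eq_zero_iff_of_nonpos fun s _ => hterm s).mp h2 s (Finset.mem_univ s)
      exact (mul_eq_zero.mp this).resolve_right (M.simpleCoroot_simpleRoot_neg hs).ne
  by_contra! hcon
  have main : ∀ (p q : S) (w : (dynkinDiagram M).Walk p q), κ q = 0 →
      (∀ r ∈ w.support, u (simpleRoot r) c = 0) → κ p = 0 := by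
    intro p q w
    induction w with
    | nil => exact fun h _ => h
    | cons h w ih =>
      intro hq hw
      exact (step _ (ih hq fun r hr => hw r (by simp [hr])) (hw _ (by simp))).2 _ h
  exact (step c (main c b w hb hcon) (hcon c (by simp))).1 rfl

/-! ### The retraction onto a standard parabolic subgroup -/

/-- The elements of the reflection group which keep the simple roots indexed by `X` positive.
They are the shortest representatives of the left cosets of the parabolic subgroup of `X`. -/
abbrev Chamber (X : Set S) : Type _ :=
  {u : (S → ℝ) ≃ₗ[ℝ] (S → ℝ) // u ∈ M.reflGroup Set.univ ∧ ∀ t ∈ X, 0 ≤ u (simpleRoot t)}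

variable {M} {X : Set S}

lemma Chamber.not_hit_simpleRefl {u : M.Chamber X} {s : S} :
    ¬ ∃ t ∈ X, M.simpleRefl s (u.1 (simpleRoot t)) = simpleRoot s := by
  rintro ⟨t, ht, h⟩
  have h1 := congrArg (M.simpleRefl s) h
  rw [simpleRefl_simpleRefl, simpleRefl_simpleRoot_self] at h1
  have h2 := u.2.2 t ht s
  rw [h1, Pi.neg_apply, simpleRoot_self] at h2
  norm_num at h2

/-- The chamber obtained from `u` by applying `s`, if no simple root of `X` becomes negative. -/
noncomputable def Chamber.move (u : M.Chamber X) (s : S)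
    (h : ¬ ∃ t ∈ X, u.1 (simpleRoot t) = simpleRoot s) : M.Chamber X :=
  ⟨M.simpleRefl s * u.1, mul_mem (M.simpleRefl_mem trivial) u.2.1, fun t ht =>
    M.simpleRefl_nonneg u.2.1 (u.2.2 t ht) fun h' => h ⟨t, ht, h'⟩⟩

open Classical in
/-- The step taken by a power `e = ±1` of the generator `s` of the Artin group on a pair of an
element of the Artin group and a chamber: if `u` maps the simple root of some `t ∈ X` to that of
`s`, then the chamber stays and the generator `t` is recorded; otherwise the chamber moves. -/
noncomputable def chamberStep (X : Set S) (e : ℤ) (s : S) (p : ArtinGroup M × M.Chamber X) :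
    ArtinGroup M × M.Chamber X :=
  if h : ∃ t ∈ X, p.2.1 (simpleRoot t) = simpleRoot s then
    ((PresentedGroup.of h.choose) ^ e * p.1, p.2)
  else (p.1, p.2.move s h)

lemma chamberStep_of_hit (e : ℤ) {s t : S} {g : ArtinGroup M} {u : M.Chamber X} (ht : t ∈ X)
    (h : u.1 (simpleRoot t) = simpleRoot s) :
    chamberStep X e s (g, u) = ((PresentedGroup.of t) ^ e * g, u) := by
  have hex : ∃ t ∈ X, u.1 (simpleRoot t) = simpleRoot s := ⟨t, ht, h⟩
  have : hex.choose = t :=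
    simpleRoot_injective (u.1.injective (hex.choose_spec.2.trans h.symm))
  rw [chamberStep, dif_pos hex, this]

lemma chamberStep_of_not_hit (e : ℤ) {s : S} {g : ArtinGroup M} {u : M.Chamber X}
    (h : ¬ ∃ t ∈ X, u.1 (simpleRoot t) = simpleRoot s) :
    chamberStep X e s (g, u) = (g, u.move s h) := by
  rw [chamberStep, dif_neg h]

lemma chamberStep_chamberStep (e : ℤ) (s : S) (p : ArtinGroup M × M.Chamber X) :
    chamberStep X (-e) s (chamberStep X e s p) = p := by
  obtain ⟨g, u⟩ := p
  by_cases h : ∃ t ∈ X, u.1 (simpleRoot t) = simpleRoot s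
  · obtain ⟨t, ht, h⟩ := h
    rw [chamberStep_of_hit e ht h, chamberStep_of_hit (-e) ht h]
    simp
  · rw [chamberStep_of_not_hit e h, chamberStep_of_not_hit (-e) Chamber.not_hit_simpleRefl]
    congr 1
    apply Subtype.ext
    change M.simpleRefl s * (M.simpleRefl s * u.1) = u.1
    rw [← mul_assoc, simpleRefl_mul_self, one_mul]

/-- The permutation of pairs by which a generator of the Artin group acts. -/
noncomputable def chamberPerm (X : Set S) (s : S) : Equiv.Perm (ArtinGroup M × M.Chamber X) where
  toFun := chamberStep X 1 s
  invFun := chamberStep X (-1) s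
  left_inv := chamberStep_chamberStep 1 s
  right_inv := chamberStep_chamberStep (-1) s

lemma chamberPerm_of_hit {s t : S} {g : ArtinGroup M} {u : M.Chamber X} (ht : t ∈ X)
    (h : u.1 (simpleRoot t) = simpleRoot s) :
    chamberPerm X s (g, u) = (PresentedGroup.of t * g, u) := by
  have := chamberStep_of_hit 1 (g := g) ht h
  rwa [zpow_one] at this

lemma chamberPerm_of_not_hit {s : S} {g : ArtinGroup M} {u : M.Chamber X}
    (h : ¬ ∃ t ∈ X, u.1 (simpleRoot t) = simpleRoot s) :
    chamberPerm X s (g, u) = (g, u.move s h) :=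
  chamberStep_of_not_hit 1 h

/-- The action of an alternating word. -/
noncomputable def altPerm (X : Set S) (s t : S) (k : ℕ) :
    Equiv.Perm (ArtinGroup M × M.Chamber X) :=
  ((alternatingWord s t k).map (chamberPerm X)).prod

lemma altPerm_succ (s t : S) (k : ℕ) (p : ArtinGroup M × M.Chamber X) :
    altPerm X s t (k + 1) p = chamberPerm X (altLetter s t k) (altPerm X s t k p) := by
  rw [altPerm, alternatingWord_succ_eq_cons, List.map_cons, List.prod_cons]
  rfl

/-- A chamber mapping two simple roots of `X` to those of `s` and `t` does not move. -/
lemma altPerm_of_two_hits {s t a b : S} (ha : a ∈ X) (hb : b ∈ X) {g : ArtinGroup M}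
    {u : M.Chamber X} (has : u.1 (simpleRoot a) = simpleRoot s)
    (hbt : u.1 (simpleRoot b) = simpleRoot t) (k : ℕ) :
    altPerm X s t k (g, u) =
      (((alternatingWord a b k).map PresentedGroup.of).prod * g, u) := by
  induction k with
  | zero => simp [altPerm, alternatingWord]
  | succ k ih =>
    have h : altLetter a b k ∈ X ∧
        u.1 (simpleRoot (altLetter a b k)) = simpleRoot (altLetter s t k) := by
      by_cases hk : Even k <;> simp [altLetter, hk, ha, hb, has, hbt]
    rw [altPerm_succ, ih, chamberPerm_of_hit h.1 h.2, alternatingWord_succ_eq_cons a b,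
      List.map_cons, List.prod_cons, mul_assoc]

lemma label_eq_of_apply_eq {u : (S → ℝ) ≃ₗ[ℝ] (S → ℝ)} (hu : u ∈ M.reflGroup Set.univ)
    {s t a b : S} (hst : s ≠ t) (has : u (simpleRoot a) = simpleRoot s)
    (hbt : u (simpleRoot b) = simpleRoot t) : a ≠ b ∧ M a b = M s t := by
  have hab : a ≠ b := by
    rintro rfl
    exact hst (simpleRoot_injective (has.symm.trans hbt))
  refine ⟨hab, ?_⟩
  have h := M.rootForm_reflGroup hu (simpleRoot a) (simpleRoot b)
  rw [has, hbt, rootForm_simpleRoot_left, rootForm_simpleRoot_left, simpleCoroot_simpleRoot,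
    simpleCoroot_simpleRoot] at h
  have hmem : ∀ m : ℕ, Real.pi / m ∈ Set.Icc 0 Real.pi := by
    intro m
    refine ⟨div_nonneg Real.pi_pos.le (Nat.cast_nonneg m), ?_⟩
    rcases Nat.eq_zero_or_pos m with rfl | hm
    · simpa using Real.pi_pos.le
    · exact div_le_self Real.pi_pos.le (by exact_mod_cast hm)
  have h2 : Real.pi / M s t = Real.pi / M a b :=
    Real.injOn_cos (hmem _) (hmem _) (by linarith)
  have h3 : (M s t : ℝ) = M a b := by
    rw [div_eq_mul_inv, div_eq_mul_inv] at h2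
    exact inv_injective (mul_left_cancel₀ Real.pi_ne_zero h2)
  exact_mod_cast h3.symm

/-- If two simple roots are mapped to positive roots in the span of the simple roots of `s` and
`t`, then they are mapped to these two simple roots. -/
lemma two_hits_of_span {u : (S → ℝ) ≃ₗ[ℝ] (S → ℝ)} (hu : u ∈ M.reflGroup Set.univ) {s t a b : S}
    (hst : s ≠ t) (hab : a ≠ b) (ha0 : 0 ≤ u (simpleRoot a)) (hb0 : 0 ≤ u (simpleRoot b))
    (ha : ∀ r ≠ s, r ≠ t → u (simpleRoot a) r = 0)
    (hb : ∀ r ≠ s, r ≠ t → u (simpleRoot b) r = 0) :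
    u (simpleRoot a) = simpleRoot s ∧ u (simpleRoot b) = simpleRoot t ∨
      u (simpleRoot b) = simpleRoot s ∧ u (simpleRoot a) = simpleRoot t := by
  set v := u (simpleRoot a) with hv
  set w := u (simpleRoot b) with hw
  -- A combination of the two images determines its coefficients.
  have hind : ∀ x y : ℝ, x • v + y • w = 0 → x = 0 ∧ y = 0 := by
    intro x y h
    rw [hv, hw, ← map_smul, ← map_smul, ← map_add, LinearEquiv.map_eq_zero_iff] at h
    have h1 := congrFun h a
    have h2 := congrFun h b
    simp [simpleRoot_self, simpleRoot_of_ne hab, simpleRoot_of_ne hab.symm] at h1 h2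
    exact ⟨h1, h2⟩
  have hvw : ∀ x y : ℝ, ∀ z : S → ℝ, (∀ r ≠ s, r ≠ t → z r = 0) → x * v s + y * w s = z s →
      x * v t + y * w t = z t → x • v + y • w = z := by
    intro x y z hz h1 h2
    ext r
    by_cases hrs : r = s
    · subst hrs; simpa using h1
    by_cases hrt : r = t
    · subst hrt; simpa using h2
    simp [ha r hrs hrt, hb r hrs hrt, hz r hrs hrt]
  -- A simple root is mapped back to a root, whose two coordinates have the same sign.
  have hsign : ∀ (x y : ℝ) (r : S), x • v + y • w = simpleRoot r → 0 ≤ x * y := by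
    intro x y r h
    have e : u⁻¹ (simpleRoot r) = x • simpleRoot a + y • simpleRoot b := by
      rw [← h, hv, hw, ← map_smul, ← map_smul, ← map_add]
      exact u.symm_apply_apply _
    rcases M.nonneg_or_nonpos (inv_mem hu) r with h1 | h1 <;>
    · rw [e] at h1
      have h2 := h1 a
      have h3 := h1 b
      simp [simpleRoot_self, simpleRoot_of_ne hab, simpleRoot_of_ne hab.symm] at h2 h3
      first | exact mul_nonneg h2 h3 | exact mul_nonneg_of_nonpos_of_nonpos h2 h3
  have hD : v s * w t - v t * w s ≠ 0 := by
    intro hD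
    have h1 := hind (w s) (-v s) (hvw _ _ 0 (by simp) (by simp; ring) (by simp; linarith))
    have h2 := hind (w t) (-v t) (hvw _ _ 0 (by simp) (by simp; linarith) (by simp; ring))
    have h3 := hind 1 0 (hvw _ _ 0 (by simp) (by simp; linarith [h1.2]) (by simp; linarith [h2.2]))
    exact one_ne_zero h3.1
  set D := v s * w t - v t * w s with hDdef
  have hs := hsign (w t / D) (-v t / D) s (hvw _ _ _ (fun r h _ => simpleRoot_of_ne h)
    (by rw [simpleRoot_self]; field_simp; rw [hDdef]; ring)
    (by rw [simpleRoot_of_ne hst.symm]; field_simp; ring))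
  have ht := hsign (-w s / D) (v s / D) t (hvw _ _ _ (fun r _ h => simpleRoot_of_ne h)
    (by rw [simpleRoot_of_ne hst]; field_simp; ring)
    (by rw [simpleRoot_self]; field_simp; rw [hDdef]; ring))
  have hD2 : 0 < D * D := mul_self_pos.mpr hD
  have h1 : w t * v t ≤ 0 := by
    rw [div_mul_div_comm, le_div_iff₀ hD2] at hs
    linarith
  have h2 : w s * v s ≤ 0 := by
    rw [div_mul_div_comm, le_div_iff₀ hD2] at ht
    linarith
  have h1' : w t * v t = 0 := le_antisymm h1 (mul_nonneg (hb0 t) (ha0 t))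
  have h2' : w s * v s = 0 := le_antisymm h2 (mul_nonneg (hb0 s) (ha0 s))
  have simple : ∀ {c x y : S}, 0 ≤ u (simpleRoot c) →
      (∀ r ≠ s, r ≠ t → u (simpleRoot c) r = 0) → (∀ r, r = s ∨ r = t → r ≠ x → r = y) →
      u (simpleRoot c) y = 0 → u (simpleRoot c) = simpleRoot x := by
    intro c x y hc h hxy hy
    refine M.eq_simpleRoot_of_forall_ne hu hc fun r hr => ?_
    by_cases hr' : r = s ∨ r = t
    · rw [hxy r hr' hr, hy]
    · push Not at hr'
      exact h r hr'.1 hr'.2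
  have cs : ∀ r, r = s ∨ r = t → r ≠ s → r = t := fun r h h' => h.resolve_left h'
  have ct : ∀ r, r = s ∨ r = t → r ≠ t → r = s := fun r h h' => h.resolve_right h'
  rcases mul_eq_zero.mp h1' with h | h
  · right
    have hws : w s ≠ 0 := by rintro h'; apply hD; rw [hDdef, h, h']; ring
    have hvs := (mul_eq_zero.mp h2').resolve_left hws
    exact ⟨simple hb0 hb cs h, simple ha0 ha ct hvs⟩
  · left
    have hvs : v s ≠ 0 := by rintro h'; apply hD; rw [hDdef, h, h']; ring
    have hws := (mul_eq_zero.mp h2').resolve_right hvs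
    exact ⟨simple ha0 ha cs h, simple hb0 hb ct hws⟩

lemma simpleRefl_mul_of_apply_eq {u : (S → ℝ) ≃ₗ[ℝ] (S → ℝ)} (hu : u ∈ M.reflGroup Set.univ)
    {s t : S} (h : u (simpleRoot t) = simpleRoot s) :
    M.simpleRefl s * u * M.simpleRefl t = u := by
  have key : M.simpleRefl s * u = u * M.simpleRefl t := by
    ext1 x
    rw [LinearEquiv.mul_apply, LinearEquiv.mul_apply, simpleRefl_apply, simpleRefl_apply, map_sub,
      map_smul, h, ← rootForm_simpleRoot_left, ← h, M.rootForm_reflGroup hu,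
      rootForm_simpleRoot_left]
  rw [key, mul_assoc, simpleRefl_mul_self, mul_one]

lemma wordRefl_alt_apply_of_ne (s t : S) (k : ℕ) (x : S → ℝ) {r : S} (hs : r ≠ s) (ht : r ≠ t) :
    M.wordRefl (alternatingWord s t k) x r = x r :=
  M.reflGroup_apply_of_notMem (M.hasWord_alternatingWord s t k).mem_reflGroup
    (by simp [hs, ht]) x

lemma altLetter_of_ne {s t r : S} (k : ℕ) (hs : r ≠ s) (ht : r ≠ t) : r ≠ altLetter s t k := by
  rcases altLetter_eq_or s t k with ⟨h, -⟩ | ⟨h, -⟩ <;> rw [h] <;> assumption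

/-- If no simple root of `X` is mapped into the span of the simple roots of `s` and `t`, then
the chamber moves along every step of an alternating word. -/
lemma altPerm_of_no_hit {s t : S} {g : ArtinGroup M} {u : M.Chamber X}
    (h : ∀ a ∈ X, ¬ ∀ r ≠ s, r ≠ t → u.1 (simpleRoot a) r = 0) (k : ℕ) :
    (altPerm X s t k (g, u)).1 = g ∧
      (altPerm X s t k (g, u)).2.1 = M.wordRefl (alternatingWord s t k) * u.1 := by
  induction k with
  | zero => exact ⟨rfl, rfl⟩
  | succ k ih =>
    obtain ⟨g', u', hp⟩ : ∃ g' u', altPerm X s t k (g, u) = (g', u') := ⟨_, _, rfl⟩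
    rw [altPerm_succ, hp]
    rw [hp] at ih
    obtain ⟨h1, h2⟩ := ih
    dsimp only at h1 h2
    have hn : ¬ ∃ a ∈ X, u'.1 (simpleRoot a) = simpleRoot (altLetter s t k) := by
      rintro ⟨a, ha, h'⟩
      refine h a ha fun r hs ht => ?_
      rw [← wordRefl_alt_apply_of_ne (M := M) s t k (u.1 (simpleRoot _)) hs ht, ← LinearEquiv.mul_apply, ← h2, h',
        simpleRoot_of_ne (altLetter_of_ne k hs ht)]
    rw [chamberPerm_of_not_hit hn]
    refine ⟨h1, ?_⟩
    rw [wordRefl_alt_succ, mul_assoc, ← h2]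
    rfl

/-- If exactly one simple root of `X`, that of `a`, is mapped into the span of the simple roots
of `s` and `t`, then the alternating word of length `M s t` records `a` exactly once. -/
lemma altPerm_of_one_hit {s t a : S} (hst : s ≠ t) (hm : M s t ≠ 0) (ha : a ∈ X)
    {g : ArtinGroup M} {u : M.Chamber X}
    (hspan : ∀ r ≠ s, r ≠ t → u.1 (simpleRoot a) r = 0)
    (huniq : ∀ b ∈ X, (∀ r ≠ s, r ≠ t → u.1 (simpleRoot b) r = 0) → b = a) :
    (altPerm X s t (M s t) (g, u)).1 = PresentedGroup.of a * g ∧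
      (altPerm X s t (M s t) (g, u)).2.1 =
        M.wordRefl (alternatingWord s t (M s t)) * u.1 * M.simpleRefl a := by
  have h2 := M.two_le_of_ne hst hm
  -- After the label `a` has been recorded, the image of the simple root of `a` is a root of the
  -- dihedral group whose coordinate at the previous letter stays positive.
  have main : ∀ k ≤ M s t,
      ((altPerm X s t k (g, u)).1 = g ∧
        (altPerm X s t k (g, u)).2.1 = M.wordRefl (alternatingWord s t k) * u.1) ∨
      ((altPerm X s t k (g, u)).1 = PresentedGroup.of a * g ∧
        (altPerm X s t k (g, u)).2.1 =
          M.wordRefl (alternatingWord s t k) * u.1 * M.simpleRefl a ∧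
        ∃ j < k, (altPerm X s t k (g, u)).2.1 (simpleRoot a) =
          dihedralCoeff (Real.cos (Real.pi / M s t)) (j + 1) •
              simpleRoot (altLetter s t (k + 1)) +
            dihedralCoeff (Real.cos (Real.pi / M s t)) j • simpleRoot (altLetter s t k)) := by
    intro k
    induction k with
    | zero => exact fun _ => Or.inl ⟨rfl, rfl⟩
    | succ k ih =>
      intro hk
      specialize ih (by lia)
      obtain ⟨g', u', hp⟩ : ∃ g' u', altPerm X s t k (g, u) = (g', u') := ⟨_, _, rfl⟩
      rw [altPerm_succ, hp]
      rw [hp] at ih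
      dsimp only at ih
      rcases ih with ⟨hg, hu⟩ | ⟨hg, hu, j, hj, hroot⟩
      · by_cases hhit : ∃ b ∈ X, u'.1 (simpleRoot b) = simpleRoot (altLetter s t k)
        · obtain ⟨b, hb, hhit⟩ := hhit
          obtain rfl : b = a := huniq b hb fun r hs ht => by
            rw [← wordRefl_alt_apply_of_ne (M := M) s t k (u.1 (simpleRoot _)) hs ht, ← LinearEquiv.mul_apply, ← hu,
              hhit, simpleRoot_of_ne (altLetter_of_ne k hs ht)]
          rw [chamberPerm_of_hit hb hhit]
          refine Or.inr ⟨by rw [hg], ?_, 0, by lia, ?_⟩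
          · rw [wordRefl_alt_succ, mul_assoc (M.simpleRefl _), ← hu]
            exact (simpleRefl_mul_of_apply_eq u'.2.1 hhit).symm
          · rw [hhit, altLetter_add_two]
            simp [dihedralCoeff]
        · rw [chamberPerm_of_not_hit hhit]
          refine Or.inl ⟨hg, ?_⟩
          rw [wordRefl_alt_succ, mul_assoc, ← hu]
          rfl
      · have hn : ¬ ∃ b ∈ X, u'.1 (simpleRoot b) = simpleRoot (altLetter s t k) := by
          rintro ⟨b, hb, hhit⟩
          obtain rfl : b = a := huniq b hb fun r hs ht => by
            have e : u'.1 (simpleRoot b) r = 0 := by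
              rw [hhit, simpleRoot_of_ne (altLetter_of_ne k hs ht)]
            rw [hu, LinearEquiv.mul_apply, LinearEquiv.mul_apply,
              wordRefl_alt_apply_of_ne s t k _ hs ht, simpleRefl_apply, map_sub, map_smul,
              Pi.sub_apply, Pi.smul_apply, hspan r hs ht] at e
            simpa using e
          have e := congrFun (hroot.symm.trans hhit) (altLetter s t (k + 1))
          have hne := altLetter_ne hst k
          have hpos := dihedralCoeff_pos (k := j + 1) h2 (by lia) (by lia)
          simp [simpleRoot_self, simpleRoot_of_ne hne] at e
          exact hpos.ne' e
        rw [chamberPerm_of_not_hit hn]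
        refine Or.inr ⟨hg, ?_, j + 1, by lia, ?_⟩
        · rw [wordRefl_alt_succ, mul_assoc (M.simpleRefl _), mul_assoc (M.simpleRefl _), ← hu]
          rfl
        · change M.simpleRefl _ (u'.1 (simpleRoot a)) = _
          rw [hroot, simpleRefl_dihedralCoeff]
  rcases main (M s t) le_rfl with ⟨-, hu⟩ | ⟨hg, hu, -⟩
  · -- The longest element makes the positive root `u (simpleRoot a)` negative.
    exfalso
    have hpos := (altPerm X s t (M s t) (g, u)).2.2.2 a ha
    have hx0 := u.2.2 a ha
    set x := u.1 (simpleRoot a) with hx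
    have hxe : x = x s • simpleRoot s + x t • simpleRoot t := by
      ext r
      by_cases hrs : r = s
      · subst hrs; simp [simpleRoot_self, simpleRoot_of_ne hst]
      by_cases hrt : r = t
      · subst hrt; simp [simpleRoot_self, simpleRoot_of_ne hst.symm]
      simp [hspan r hrs hrt, simpleRoot_of_ne hrs, simpleRoot_of_ne hrt]
    rw [hu, LinearEquiv.mul_apply, ← hx, hxe, map_add, map_smul, map_smul,
      wordRefl_longest_simpleRoot_left M hst hm, wordRefl_longest_simpleRoot_right M hst hm]
      at hpos
    have h1 := hpos (altLetter s t (M s t + 1))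
    have h2 := hpos (altLetter s t (M s t))
    have hne := altLetter_ne hst (M s t)
    simp [simpleRoot_self, simpleRoot_of_ne hne, simpleRoot_of_ne hne.symm] at h1 h2
    have h3 : x s = 0 := le_antisymm h1 (hx0 s)
    have h4 : x t = 0 := le_antisymm h2 (hx0 t)
    apply reflGroup_apply_ne_zero u.1 a
    rw [← hx, hxe, h3, h4]
    simp
  · exact ⟨hg, hu⟩

/-- The permutations attached to the generators satisfy the braid relations. -/
theorem altPerm_braid {s t : S} (hst : s ≠ t) (hm : M s t ≠ 0) :
    altPerm (M := M) X s t (M s t) = altPerm X t s (M s t) := by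
  ext1 ⟨g, u⟩
  have hm' : M t s ≠ 0 := by rwa [M.symmetric]
  have swap : ∀ x : S → ℝ, (∀ r ≠ s, r ≠ t → x r = 0) ↔ ∀ r ≠ t, r ≠ s → x r = 0 :=
    fun x => ⟨fun h r h1 h2 => h r h2 h1, fun h r h1 h2 => h r h2 h1⟩
  by_cases htwo : ∃ a ∈ X, ∃ b ∈ X, u.1 (simpleRoot a) = simpleRoot s ∧
      u.1 (simpleRoot b) = simpleRoot t
  · obtain ⟨a, ha, b, hb, has, hbt⟩ := htwo
    rw [altPerm_of_two_hits ha hb has hbt, altPerm_of_two_hits hb ha hbt has]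
    obtain ⟨hab, hM⟩ := label_eq_of_apply_eq u.2.1 hst has hbt
    have hrel := PresentedGroup.one_of_mem (rels := artinRelations M)
      (show _ ∈ artinRelations M from ⟨a, b, hab, by rwa [hM], rfl⟩)
    rw [map_mul, map_inv, mul_inv_eq_one, map_list_prod, map_list_prod, List.map_map,
      List.map_map, hM] at hrel
    congr 2
  by_cases hone : ∃ a ∈ X, ∀ r ≠ s, r ≠ t → u.1 (simpleRoot a) r = 0
  · obtain ⟨a, ha, hspan⟩ := hone
    have huniq : ∀ b ∈ X, (∀ r ≠ s, r ≠ t → u.1 (simpleRoot b) r = 0) → b = a := by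
      intro b hb hb'
      by_contra hba
      rcases two_hits_of_span u.2.1 hst hba (u.2.2 b hb) (u.2.2 a ha) hb' hspan with h | h
      exacts [htwo ⟨b, hb, a, ha, h⟩, htwo ⟨a, ha, b, hb, h⟩]
    have h1 := altPerm_of_one_hit hst hm ha (g := g) hspan huniq
    have h2 := altPerm_of_one_hit hst.symm hm' ha (g := g) ((swap _).mp hspan)
      fun b hb hb' => huniq b hb ((swap _).mpr hb')
    rw [M.symmetric t s, ← M.wordRefl_braid hst hm] at h2
    exact Prod.ext (h1.1.trans h2.1.symm) (Subtype.ext (h1.2.trans h2.2.symm))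
  · push Not at hone
    have h1 := altPerm_of_no_hit (s := s) (t := t) (g := g) (u := u)
      (fun a ha h => by obtain ⟨r, h1, h2, h3⟩ := hone a ha; exact h3 (h r h1 h2)) (M s t)
    have h2 := altPerm_of_no_hit (s := t) (t := s) (g := g) (u := u)
      (fun a ha h => by obtain ⟨r, h1, h2, h3⟩ := hone a ha; exact h3 (h r h2 h1)) (M s t)
    rw [← M.wordRefl_braid hst hm] at h2
    exact Prod.ext (h1.1.trans h2.1.symm) (Subtype.ext (h1.2.trans h2.2.symm))

/-- The action of the Artin group on pairs of an element of the Artin group and a chamber. Its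
first component, applied to the pair of neutral elements, is a set-theoretic retraction of the
Artin group onto its standard parabolic subgroup of `X`. -/
noncomputable def chamberAction (M : CoxeterMatrix S) (X : Set S) :
    ArtinGroup M →* Equiv.Perm (ArtinGroup M × M.Chamber X) :=
  PresentedGroup.toGroup (f := chamberPerm X) (by
    rintro r ⟨s, t, hst, hm, rfl⟩
    rw [map_mul, map_inv, mul_inv_eq_one, map_list_prod, map_list_prod, List.map_map,
      List.map_map]
    have h := altPerm_braid (M := M) (X := X) hst hm
    rw [altPerm, altPerm] at h
    have e : (FreeGroup.lift (chamberPerm (M := M) X) : _ → _) ∘ FreeGroup.of =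
        chamberPerm X := funext fun s => FreeGroup.lift_apply_of
    rw [e]
    exact h)

lemma chamberAction_of (s : S) :
    chamberAction M X (PresentedGroup.of s) = chamberPerm X s :=
  PresentedGroup.toGroup.of _

/-- Invariance of a set of pairs under the generators of a standard parabolic subgroup and their
inverses gives invariance under this subgroup. -/
lemma chamberAction_induction {Z : Set S} (P : ArtinGroup M × M.Chamber X → Prop)
    (h : ∀ s ∈ Z, ∀ e : ℤ, ∀ p, P p → P (chamberStep X e s p))
    {g : ArtinGroup M} (hg : g ∈ standardParabolic M Z) (p : ArtinGroup M × M.Chamber X)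
    (hp : P p) : P (chamberAction M X g p) := by
  have key : ∀ g ∈ standardParabolic M Z, ∀ p, P p →
      P (chamberAction M X g p) ∧ P (chamberAction M X g⁻¹ p) := by
    intro g hg
    induction hg using Subgroup.closure_induction with
    | mem x hx =>
      obtain ⟨s, hs, rfl⟩ := hx
      intro p hp
      rw [map_inv, chamberAction_of]
      exact ⟨h s hs 1 p hp, h s hs (-1) p hp⟩
    | one => intro p hp; simpa using hp
    | mul x y _ _ hx hy =>
      intro p hp
      rw [mul_inv_rev, map_mul, map_mul]
      exact ⟨(hx _ (hy p hp).1).1, (hy _ (hx p hp).2).2⟩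
    | inv x _ hx =>
      intro p hp
      rw [inv_inv]
      exact (hx p hp).symm
  exact (key g hg p hp).1

/-- The chamber of the neutral element. -/
def Chamber.base (M : CoxeterMatrix S) (X : Set S) : M.Chamber X :=
  ⟨1, one_mem _, fun t _ => simpleRoot_nonneg t⟩

lemma of_mem_standardParabolic {Z : Set S} {s : S} (hs : s ∈ Z) :
    (PresentedGroup.of s : ArtinGroup M) ∈ standardParabolic M Z :=
  Subgroup.subset_closure ⟨s, hs, rfl⟩

/-- The retraction is the identity on the standard parabolic subgroup of `X`. -/
lemma chamberAction_of_mem {h : ArtinGroup M} (hh : h ∈ standardParabolic M X)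
    (g : ArtinGroup M) :
    chamberAction M X h (g, Chamber.base M X) = (h * g, Chamber.base M X) := by
  induction hh using Subgroup.closure_induction generalizing g with
  | mem x hx =>
    obtain ⟨s, hs, rfl⟩ := hx
    rw [chamberAction_of]
    exact chamberPerm_of_hit hs rfl
  | one => simp
  | mul x y _ _ hx hy => rw [map_mul, Equiv.Perm.mul_apply, hy, hx, mul_assoc]
  | inv x _ hx =>
    rw [map_inv, Equiv.Perm.inv_eq_iff_eq, hx, mul_inv_cancel_left]

/-- The retraction maps a standard parabolic subgroup of type `Z` into the one of type `Z ∩ X`. -/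
lemma chamberAction_base {Z : Set S} {k : ArtinGroup M} (hk : k ∈ standardParabolic M Z)
    (g : ArtinGroup M) :
    (chamberAction M X k (g, Chamber.base M X)).1 * g⁻¹ ∈ standardParabolic M (Z ∩ X) ∧
      (chamberAction M X k (g, Chamber.base M X)).2.1 ∈ M.reflGroup Z := by
  refine chamberAction_induction
    (fun p => p.1 * g⁻¹ ∈ standardParabolic M (Z ∩ X) ∧ p.2.1 ∈ M.reflGroup Z) ?_ hk _
    ⟨by simp, one_mem _⟩
  rintro s hs e ⟨g', u⟩ ⟨h1, h2⟩
  by_cases hhit : ∃ t ∈ X, u.1 (simpleRoot t) = simpleRoot s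
  · obtain ⟨t, ht, hhit⟩ := hhit
    rw [chamberStep_of_hit e ht hhit]
    refine ⟨?_, h2⟩
    have htZ : t ∈ Z := by
      by_contra htZ
      have := M.reflGroup_apply_of_notMem h2 htZ (simpleRoot t)
      rw [hhit, simpleRoot_self, simpleRoot_of_ne (by rintro rfl; exact htZ hs)] at this
      exact zero_ne_one this
    rw [mul_assoc]
    exact mul_mem (zpow_mem (of_mem_standardParabolic (Set.mem_inter htZ ht)) e) h1
  · rw [chamberStep_of_not_hit e hhit]
    exact ⟨h1, mul_mem (M.simpleRefl_mem hs) h2⟩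

/-- If the root to which a chamber maps the simple root of `r` involves `c`, then `r` is never
recorded under the action of the parabolic subgroup omitting `c`. -/
lemma chamberAction_omit {c r : S} (p : ArtinGroup M × M.Chamber X)
    (hr : p.2.1 (simpleRoot r) c ≠ 0) {y : ArtinGroup M} (hy : y ∈ standardParabolic M {c}ᶜ) :
    (chamberAction M X y p).1 * p.1⁻¹ ∈ standardParabolic M {r}ᶜ := by
  refine (chamberAction_induction
    (fun q => q.1 * p.1⁻¹ ∈ standardParabolic M {r}ᶜ ∧ q.2.1 (simpleRoot r) c ≠ 0) ?_ hy _
    ⟨by simp, hr⟩).1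
  rintro s hs e ⟨g', u⟩ ⟨h1, h2⟩
  have hcs : c ≠ s := fun h => hs h.symm
  by_cases hhit : ∃ t ∈ X, u.1 (simpleRoot t) = simpleRoot s
  · obtain ⟨t, ht, hhit⟩ := hhit
    rw [chamberStep_of_hit e ht hhit]
    refine ⟨?_, h2⟩
    have htr : t ≠ r := by
      rintro rfl
      apply h2
      change u.1 _ c = 0
      rw [hhit, simpleRoot_of_ne hcs]
    rw [mul_assoc]
    exact mul_mem (zpow_mem (of_mem_standardParabolic htr) e) h1
  · rw [chamberStep_of_not_hit e hhit]
    refine ⟨h1, ?_⟩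
    change M.simpleRefl s (u.1 _) c ≠ 0
    rwa [simpleRefl_apply_of_ne M hcs]

end CoxeterMatrix

lemma standardParabolic_mono {S : Type*} {M : CoxeterMatrix S} {I J : Set S} (h : I ⊆ J) :
    standardParabolic M I ≤ standardParabolic M J :=
  Subgroup.closure_mono (Set.image_mono h)

open CoxeterMatrix in
/-- The algebraic form of the projection of a 4-cycle to the link of one of its vertices. -/
theorem exists_projection {S : Type*} [Finite S] {M : CoxeterMatrix S} {a b c d : S}
    (w : (dynkinDiagram M).Walk c b) {h k l y : ArtinGroup M}
    (hh : h ∈ standardParabolic M {a}ᶜ) (hk : k ∈ standardParabolic M {b}ᶜ)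
    (hy : y ∈ standardParabolic M {c}ᶜ) (hl : l ∈ standardParabolic M {d}ᶜ)
    (heq : h = l * y * k) :
    ∃ r ∈ w.support, ∃ g₁ g₂ : ArtinGroup M, g₁ ∈ standardParabolic M {a}ᶜ ∧
      g₁ ∈ standardParabolic M {b}ᶜ ∧ g₂ * g₁⁻¹ ∈ standardParabolic M {r}ᶜ ∧
      g₂ ∈ standardParabolic M {a}ᶜ ∧ g₂ * h⁻¹ ∈ standardParabolic M {d}ᶜ := by
  classical
  cases nonempty_fintype S
  obtain ⟨h1, h2⟩ := chamberAction_base (X := {a}ᶜ) hk 1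
  set p := chamberAction M {a}ᶜ k (1, Chamber.base M {a}ᶜ) with hp
  rw [inv_one, mul_one] at h1
  obtain ⟨r, hr, hrc⟩ := M.exists_mem_support_apply_ne_zero w h2
  have h3 := chamberAction_omit p hrc hy
  have h4 : chamberAction M {a}ᶜ y p =
      chamberAction M {a}ᶜ l⁻¹ (h, Chamber.base M {a}ᶜ) := by
    have h5 := chamberAction_of_mem hh 1
    rw [mul_one, heq, map_mul, map_mul, Equiv.Perm.mul_apply, Equiv.Perm.mul_apply, ← hp, ← heq]
      at h5
    rw [map_inv, Equiv.Perm.eq_inv_iff_eq, h5]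
  obtain ⟨h5, -⟩ := chamberAction_base (X := {a}ᶜ) (inv_mem hl) h
  rw [← h4] at h5
  refine ⟨r, hr, p.1, (chamberAction M {a}ᶜ y p).1,
    standardParabolic_mono Set.inter_subset_right h1,
    standardParabolic_mono Set.inter_subset_left h1, h3, ?_,
    standardParabolic_mono Set.inter_subset_left h5⟩
  have := mul_mem (standardParabolic_mono Set.inter_subset_right h5) hh
  rwa [inv_mul_cancel_right] at this

/-! ### Betweenness in trees -/

namespace SimpleGraph

variable {V : Type*} {G : SimpleGraph V}

/-- `x` lies on every walk from `u` to `v`. In a tree this says that `x` is a vertex of the path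
from `u` to `v`. -/
def Btw (G : SimpleGraph V) (u x v : V) : Prop := ∀ p : G.Walk u v, x ∈ p.support

lemma Btw.symm {u x v : V} (h : G.Btw u x v) : G.Btw v x u := fun p => by
  simpa using h p.reverse

lemma btw_left (u v : V) : G.Btw u u v := fun p => p.start_mem_support

lemma btw_right (u v : V) : G.Btw u v v := fun p => p.end_mem_support

lemma Btw.eq {u x : V} (h : G.Btw u x u) : x = u := by simpa using h Walk.nil

lemma Btw.left_or_right {u x v : V} (h : G.Btw u x v) (w : V) : G.Btw u x w ∨ G.Btw w x v := by
  by_contra! hcon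
  simp only [Btw, not_forall] at hcon
  obtain ⟨⟨p, hp⟩, ⟨q, hq⟩⟩ := hcon
  have := h (p.append q)
  rw [Walk.mem_support_append_iff] at this
  exact this.elim hp hq

lemma Btw.trans_left {u y x v : V} (hx : G.Btw u x v) (hy : G.Btw u y x) : G.Btw u y v := by
  classical
  exact fun p => p.support_takeUntil_subset_support (hx p) (hy _)

lemma Btw.antisymm (hG : G.Connected) {u x y : V} (hx : G.Btw u x y) (hy : G.Btw u y x) :
    x = y := by
  classical
  by_contra hxy
  obtain ⟨p, hp, -⟩ := (hG u x).exists_path_of_dist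
  exact Walk.endpoint_notMem_support_takeUntil hp (hy p) hxy (hx _)

lemma Btw.trans_right (hG : G.Connected) {u y x v : V} (hx : G.Btw u x v) (hy : G.Btw u y x) :
    G.Btw y x v := by
  rcases hx.left_or_right y with h | h
  · rw [h.antisymm hG hy]
    exact btw_left _ _
  · exact h

lemma Btw.exists_of_hom {W : Type*} {H : SimpleGraph W} (f : G →g H) {u v : V} {x u' v' : W}
    (p : G.Walk u v) (h : H.Btw u' x v') (hu : f u = u') (hv : f v = v') :
    ∃ y ∈ p.support, f y = x := by
  subst hu hv
  have := h (p.map f)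
  rwa [Walk.support_map, List.mem_map] at this

lemma IsTree.btw_of_mem_support (hG : G.IsTree) {u x v : V} {p : G.Walk u v} (hp : p.IsPath)
    (hx : x ∈ p.support) : G.Btw u x v := by
  classical
  intro q
  have : q.bypass = p :=
    congrArg Subtype.val ((hG.isAcyclic.subsingleton_path u v).elim ⟨_, q.bypass_isPath⟩ ⟨p, hp⟩)
  rw [← this] at hx
  exact q.support_bypass_subset_support hx

/-- The union of the intervals joining two elements of `F`. In a tree this is the vertex set of
the subtree spanned by `F`. -/
def btwHull (G : SimpleGraph V) (F : Set V) : Set V := {x | ∃ u ∈ F, ∃ v ∈ F, G.Btw u x v}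

lemma subset_btwHull (F : Set V) : F ⊆ G.btwHull F := fun x hx => ⟨x, hx, x, hx, btw_left _ _⟩

lemma exists_btw_of_mem_btwHull {F : Set V} {x u : V} (hx : x ∈ G.btwHull F) :
    ∃ v ∈ F, G.Btw u x v := by
  obtain ⟨v, hv, w, hw, h⟩ := hx
  rcases h.left_or_right u with h | h
  exacts [⟨v, hv, h.symm⟩, ⟨w, hw, h⟩]

lemma btwHull_subset_btwHull {E F : Set V} (h : E ⊆ G.btwHull F) :
    G.btwHull E ⊆ G.btwHull F := by
  rintro x ⟨u, hu, v, hv, hx⟩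
  obtain ⟨a, ha, b, hb, hab⟩ := h hu
  obtain ⟨c, hc, d, hd, hcd⟩ := h hv
  rcases hx.left_or_right a with h1 | h1
  · exact ⟨a, ha, b, hb, hab.trans_left h1.symm⟩
  rcases h1.left_or_right c with h2 | h2
  · exact ⟨a, ha, c, hc, h2⟩
  · exact ⟨c, hc, d, hd, hcd.trans_left h2⟩

end SimpleGraph

section Subgraphs

open SimpleGraph

variable {S : Type*} {Λ : SimpleGraph S}

lemma isTree_induce_of_isLinearSubgraph {T U : Set S} (hT : (Λ.induce T).IsTree) (hUT : U ⊆ T)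
    (hU : IsLinearSubgraph Λ U) : (Λ.induce U).IsTree := by
  obtain ⟨n, ⟨e⟩⟩ := hU
  exact ⟨e.connected_iff.mpr (pathGraph_connected n),
    hT.isAcyclic.embedding (Λ.induceHomOfLE hUT)⟩

/-- The smallest subtree contains all intervals between its prescribed elements. -/
lemma coe_mem_smallestSubtree {T : Set S} {F : Set T} {x : T}
    (hx : x ∈ (Λ.induce T).btwHull F) {E : Set S} (hE : ∀ u ∈ F, (u : S) ∈ E) :
    (x : S) ∈ smallestSubtree Λ T E := by
  obtain ⟨u, hu, v, hv, h⟩ := hx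
  rintro U ⟨hUT, hEU, hU⟩
  obtain ⟨p⟩ := hU.connected ⟨u, hEU (hE u hu)⟩ ⟨v, hEU (hE v hv)⟩
  obtain ⟨y, -, rfl⟩ := Btw.exists_of_hom (Λ.induceHomOfLE hUT).toHom p h rfl rfl
  exact y.2

/-- The interval between two vertices of an induced tree is a linear subgraph. -/
lemma isLinearSubgraph_interval {T : Set S} (hT : (Λ.induce T).IsTree) (a b : T) :
    IsLinearSubgraph Λ (Subtype.val '' {x | (Λ.induce T).Btw a x b}) := by
  set G := Λ.induce T
  obtain ⟨p, hp⟩ := hT.connected.exists_walk_length_eq_dist a b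
  have hpath := p.isPath_of_length_eq_dist hp
  have hdist : ∀ i ≤ p.length, G.dist a (p.getVert i) = i := by
    intro i hi
    have h1 := G.dist_le (p.take i)
    have h2 := G.dist_le (p.drop i)
    have h3 := hT.connected.dist_triangle (u := a) (v := p.getVert i) (w := b)
    rw [Walk.take_length] at h1
    rw [Walk.drop_length] at h2
    lia
  refine ⟨p.length, ⟨RelIso.symm ⟨Equiv.ofBijective (fun i : Fin (p.length + 1) =>
    (⟨(p.getVert i : T), p.getVert i, hT.btw_of_mem_support hpath (p.getVert_mem_support i),
      rfl⟩ : (Subtype.val '' {x | G.Btw a x b} : Set S))) ⟨fun i j hij => ?_, ?_⟩, ?_⟩⟩⟩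
  · have h : p.getVert i = p.getVert j := by
      have h := congrArg Subtype.val hij
      exact Subtype.ext h
    have hi := hdist i (Nat.lt_succ_iff.mp i.2)
    have hj := hdist j (Nat.lt_succ_iff.mp j.2)
    rw [h] at hi
    exact Fin.ext (hi.symm.trans hj)
  · rintro ⟨_, x, hx, rfl⟩
    obtain ⟨i, hi, hile⟩ := Walk.mem_support_iff_exists_getVert.mp (hx p)
    exact ⟨⟨i, by lia⟩, Subtype.ext (by dsimp only; rw [hi])⟩
  · intro i j
    have hi := hdist i (Nat.lt_succ_iff.mp i.2)
    have hj := hdist j (Nat.lt_succ_iff.mp j.2)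
    rw [pathGraph_adj]
    change G.Adj (p.getVert i) (p.getVert j) ↔ _
    constructor
    · intro h
      have := hT.dist_eq_dist_add_one_of_adj a h
      lia
    · rintro (h | h)
      · rw [← h]
        exact p.adj_getVert_succ (by lia)
      · rw [← h]
        exact (p.adj_getVert_succ (by lia)).symm

lemma exists_isMaximalLinearSubgraph [Finite S] {T U : Set S} (hUT : U ⊆ T)
    (hU : IsLinearSubgraph Λ U) : ∃ T'', U ⊆ T'' ∧ IsMaximalLinearSubgraph Λ T T'' :=
  Finite.exists_le_maximal (p := fun U : Set S => U ⊆ T ∧ IsLinearSubgraph Λ U) ⟨hUT, hU⟩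

end Subgraphs

/-! ### Intersecting cosets -/

section Meets

open SimpleGraph

variable {S : Type*} {M : CoxeterMatrix S} {T : Set S}

/-- The cosets of two vertices of the relative Artin complex intersect. -/
def Meets (x y : RelArtinVertex M T) : Prop :=
  ∃ g : ArtinGroup M, QuotientGroup.mk g = x.2 ∧ QuotientGroup.mk g = y.2

lemma Meets.symm {x y : RelArtinVertex M T} (h : Meets x y) : Meets y x :=
  h.imp fun _ hg => hg.symm

lemma Meets.eq_of_label_eq {x y : RelArtinVertex M T} (h : Meets x y) (hxy : x.1 = y.1) :
    x = y := by
  obtain ⟨s, q⟩ := x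
  obtain ⟨t, q'⟩ := y
  obtain ⟨g, h1, h2⟩ := h
  dsimp only at hxy h1 h2
  subst hxy
  rw [← h1, ← h2]

lemma oneSkeleton_adj_iff {x y : RelArtinVertex M T} :
    (oneSkeleton (relArtinComplex M T)).Adj x y ↔ x ≠ y ∧ Meets x y := by
  classical
  refine and_congr_right fun _ => ⟨fun ⟨_, g, hg⟩ => ⟨g, hg x (by simp), hg y (by simp)⟩,
    fun ⟨g, hx, hy⟩ => ⟨by simp, g, fun v hv => ?_⟩⟩
  simp only [Finset.mem_insert, Finset.mem_singleton] at hv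
  rcases hv with rfl | rfl
  exacts [hx, hy]

/-- An induced 4-cycle, in terms of intersections of cosets. -/
structure MeetsCycle (x₁ x₂ x₃ x₄ : RelArtinVertex M T) : Prop where
  meets₁₂ : Meets x₁ x₂
  meets₂₃ : Meets x₂ x₃
  meets₃₄ : Meets x₃ x₄
  meets₄₁ : Meets x₄ x₁
  not_meets₁₃ : ¬ Meets x₁ x₃
  not_meets₂₄ : ¬ Meets x₂ x₄

lemma MeetsCycle.rotate {x₁ x₂ x₃ x₄ : RelArtinVertex M T} (h : MeetsCycle x₁ x₂ x₃ x₄) :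
    MeetsCycle x₂ x₃ x₄ x₁ :=
  ⟨h.2, h.3, h.4, h.1, h.6, fun h' => h.5 h'.symm⟩

lemma Meets.refl (x : RelArtinVertex M T) : Meets x x :=
  (QuotientGroup.mk_surjective x.2).imp fun _ h => ⟨h, h⟩

lemma isInducedFourCycle_iff {x₁ x₂ x₃ x₄ : RelArtinVertex M T} :
    IsInducedFourCycle (oneSkeleton (relArtinComplex M T)) x₁ x₂ x₃ x₄ ↔
      MeetsCycle x₁ x₂ x₃ x₄ := by
  constructor
  · rintro ⟨h1, h2, h3, h4, h5, h6, h7, h8⟩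
    rw [oneSkeleton_adj_iff] at *
    exact ⟨h1.2, h2.2, h3.2, h4.2, fun h => h7 ⟨h5, h⟩, fun h => h8 ⟨h6, h⟩⟩
  · rintro ⟨h1, h2, h3, h4, h5, h6⟩
    constructor <;> (try rw [oneSkeleton_adj_iff])
    · exact ⟨by rintro rfl; exact h6 h4.symm, h1⟩
    · exact ⟨by rintro rfl; exact h5 h1, h2⟩
    · exact ⟨by rintro rfl; exact h6 h2, h3⟩
    · exact ⟨by rintro rfl; exact h5 h3.symm, h4⟩
    · rintro rfl; exact h5 (.refl _)
    · rintro rfl; exact h6 (.refl _)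
    · exact fun h => h5 h.2
    · exact fun h => h6 h.2

/-- A vertex meeting the four vertices of an induced 4-cycle is adjacent to each of them. -/
lemma MeetsCycle.adj_of_meets {x₁ x₂ x₃ x₄ x : RelArtinVertex M T}
    (h : MeetsCycle x₁ x₂ x₃ x₄) (h1 : Meets x x₁) (h2 : Meets x x₂) (h3 : Meets x x₃)
    (h4 : Meets x x₄) :
    (oneSkeleton (relArtinComplex M T)).Adj x x₁ ∧
      (oneSkeleton (relArtinComplex M T)).Adj x x₂ ∧
      (oneSkeleton (relArtinComplex M T)).Adj x x₃ ∧
      (oneSkeleton (relArtinComplex M T)).Adj x x₄ := by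
  simp only [oneSkeleton_adj_iff]
  refine ⟨⟨?_, h1⟩, ⟨?_, h2⟩, ⟨?_, h3⟩, ⟨?_, h4⟩⟩ <;> rintro rfl
  exacts [h.5 h3, h.6 h4, h.5 h1.symm, h.6 h2.symm]

/-- The labeled 4-wheel condition in terms of intersections of cosets. -/
lemma labeledFourWheel_iff : LabeledFourWheel M T ↔
    ∀ x₁ x₂ x₃ x₄ : RelArtinVertex M T, MeetsCycle x₁ x₂ x₃ x₄ →
      ∃ x : RelArtinVertex M T, Meets x x₁ ∧ Meets x x₂ ∧ Meets x x₃ ∧ Meets x x₄ ∧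
        (x.1 : S) ∈ smallestSubtree (dynkinDiagram M) T
          {(x₁.1 : S), (x₂.1 : S), (x₃.1 : S), (x₄.1 : S)} := by
  refine forall₄_congr fun x₁ x₂ x₃ x₄ => ?_
  rw [isInducedFourCycle_iff]
  refine forall_congr' fun h => exists_congr fun x => ⟨?_, ?_⟩
  · simp only [oneSkeleton_adj_iff]
    rintro ⟨h1, h2, h3, h4, h5⟩
    exact ⟨h1.2, h2.2, h3.2, h4.2, h5⟩
  · rintro ⟨h1, h2, h3, h4, h5⟩
    obtain ⟨a1, a2, a3, a4⟩ := h.adj_of_meets h1 h2 h3 h4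
    exact ⟨a1, a2, a3, a4, h5⟩

/-- A vertex of the relative Artin complex of `T` with label in `U`, as a vertex of that of `U`. -/
def changeType {U : Set S} (x : RelArtinVertex M T) (hx : (x.1 : S) ∈ U) : RelArtinVertex M U :=
  ⟨⟨x.1, hx⟩, x.2⟩

lemma meetsCycle_changeType {U : Set S} {x₁ x₂ x₃ x₄ : RelArtinVertex M T}
    (h : MeetsCycle x₁ x₂ x₃ x₄) (h1 : (x₁.1 : S) ∈ U) (h2 : (x₂.1 : S) ∈ U)
    (h3 : (x₃.1 : S) ∈ U) (h4 : (x₄.1 : S) ∈ U) :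
    MeetsCycle (changeType x₁ h1) (changeType x₂ h2) (changeType x₃ h3) (changeType x₄ h4) :=
  ⟨h.1, h.2, h.3, h.4, h.5, h.6⟩

/-! ### Vertices in the link of a separating vertex -/

lemma commute_of_not_adj {s t : S} (hst : s ≠ t) (h : ¬ (dynkinDiagram M).Adj s t) :
    Commute (PresentedGroup.of s : ArtinGroup M) (PresentedGroup.of t) := by
  have hm : M s t = 2 := by
    by_contra hm
    exact h ⟨hst, hm⟩
  have hrel := PresentedGroup.one_of_mem (rels := artinRelations M)
    (show _ ∈ artinRelations M from ⟨s, t, hst, by rw [hm]; norm_num, rfl⟩)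
  rw [hm, map_mul, map_inv, mul_inv_eq_one] at hrel
  simp [CoxeterSystem.alternatingWord] at hrel
  exact hrel

/-- A standard parabolic subgroup whose type splits into two sets without edges of the Dynkin
diagram between them is the product of the two corresponding parabolic subgroups. -/
lemma exists_mul_of_no_edges {C D : Set S}
    (hCD : ∀ c ∈ C, ∀ d ∈ D, c ≠ d ∧ ¬ (dynkinDiagram M).Adj c d) {k : ArtinGroup M}
    (hk : k ∈ standardParabolic M (C ∪ D)) :
    ∃ p ∈ standardParabolic M D, ∃ q ∈ standardParabolic M C, k = p * q := by
  have hcent : standardParabolic M C ≤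
      Subgroup.centralizer (standardParabolic M D : Set (ArtinGroup M)) := by
    rw [standardParabolic, standardParabolic, Subgroup.centralizer_closure, Subgroup.closure_le]
    rintro _ ⟨c, hc, rfl⟩
    rw [SetLike.mem_coe, Subgroup.mem_centralizer_iff]
    rintro _ ⟨d, hd, rfl⟩
    exact (commute_of_not_adj (hCD c hc d hd).1 (hCD c hc d hd).2).symm.eq
  have hcomm : ∀ q ∈ standardParabolic M C, ∀ p ∈ standardParabolic M D, p * q = q * p :=
    fun q hq => Subgroup.mem_centralizer_iff.mp (hcent hq)
  induction hk using Subgroup.closure_induction with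
  | mem x hx =>
    obtain ⟨s, hs | hs, rfl⟩ := hx
    · exact ⟨1, one_mem _, _, Subgroup.subset_closure ⟨s, hs, rfl⟩, (one_mul _).symm⟩
    · exact ⟨_, Subgroup.subset_closure ⟨s, hs, rfl⟩, 1, one_mem _, (mul_one _).symm⟩
  | one => exact ⟨1, one_mem _, 1, one_mem _, (one_mul _).symm⟩
  | mul x y _ _ hx hy =>
    obtain ⟨p, hp, q, hq, rfl⟩ := hx
    obtain ⟨p', hp', q', hq', rfl⟩ := hy
    refine ⟨p * p', mul_mem hp hp', q * q', mul_mem hq hq', ?_⟩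
    rw [mul_assoc, ← mul_assoc q, ← hcomm q hq p' hp', mul_assoc, mul_assoc]
  | inv x _ hx =>
    obtain ⟨p, hp, q, hq, rfl⟩ := hx
    exact ⟨p⁻¹, inv_mem hp, q⁻¹, inv_mem hq, by
      rw [← mul_inv_rev, ← hcomm q hq p hp]⟩

/-- If the label of `y` separates the labels of `x` and `z`, then the cosets of any two vertices
`x` and `z` adjacent to `y` intersect. -/
theorem Meets.trans_of_btw (hadm : IsAdmissible (dynkinDiagram M) T) {x y z : RelArtinVertex M T}
    (hxy : Meets x y) (hyz : Meets y z)
    (h : ((dynkinDiagram M).induce T).Btw x.1 y.1 z.1) : Meets x z := by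
  by_cases hxy' : y.1 = x.1
  · rwa [hxy.symm.eq_of_label_eq hxy'] at hyz
  by_cases hyz' : y.1 = z.1
  · rwa [hyz.eq_of_label_eq hyz'] at hxy
  obtain ⟨⟨s, hs⟩, qx⟩ := x
  obtain ⟨⟨r, hr⟩, qy⟩ := y
  obtain ⟨⟨t, ht⟩, qz⟩ := z
  have hsr : s ≠ r := fun h => hxy' (Subtype.ext h.symm)
  have htr : t ≠ r := fun h => hyz' (Subtype.ext h.symm)
  obtain ⟨g, hgx, hgy⟩ := hxy
  obtain ⟨g', hgy', hgz⟩ := hyz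
  dsimp only at h hgx hgy hgy' hgz
  have hsep := hadm r hr s t ⟨hs, hsr⟩ ⟨ht, htr⟩ (by
    rintro ⟨p⟩
    obtain ⟨v, -, hv⟩ :=
      Btw.exists_of_hom ((dynkinDiagram M).induceHomOfLE Set.sdiff_subset).toHom p h rfl rfl
    exact v.2.2 (congrArg Subtype.val hv))
  -- `C` is the component of the Dynkin diagram minus `r` which contains `s`.
  set C : Set S := {v | ∃ hv : v ∈ ({r}ᶜ : Set S),
    ((dynkinDiagram M).induce {r}ᶜ).Reachable ⟨s, hsr⟩ ⟨v, hv⟩} with hC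
  have hk : g⁻¹ * g' ∈ standardParabolic M (C ∪ ({r}ᶜ \ C)) := by
    have hCr : C ⊆ {r}ᶜ := fun v hv => hv.1
    rw [Set.union_sdiff_cancel hCr]
    exact QuotientGroup.eq.mp (hgy.trans hgy'.symm)
  obtain ⟨p, hp, q, hq, hpq⟩ := exists_mul_of_no_edges (by
    rintro c ⟨hc, hcr⟩ d ⟨hd, hdC⟩
    refine ⟨?_, fun hadj => hdC ⟨hd, hcr.trans (Adj.reachable ?_)⟩⟩
    · rintro rfl
      exact hdC ⟨hc, hcr⟩
    · exact hadj) hk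
  refine ⟨g * p, ?_, ?_⟩
  · rw [← hgx]
    refine QuotientGroup.eq.mpr ?_
    rw [mul_inv_rev, inv_mul_cancel_right]
    refine inv_mem (standardParabolic_mono ?_ hp)
    rintro v ⟨-, hv⟩ rfl
    exact hv ⟨hsr, Reachable.refl _⟩
  · rw [← hgz]
    refine QuotientGroup.eq.mpr ?_
    rw [mul_inv_rev, mul_assoc, hpq, inv_mul_cancel_left]
    refine standardParabolic_mono ?_ hq
    rintro v ⟨hv, hreach⟩ rfl
    exact hsep hreach

/-- Projecting `x₃` to the link of `x₁` in a 4-cycle: along every walk in the Dynkin diagram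
from the label of `x₃` to that of `x₂` there is the label of a vertex meeting the other three
vertices. -/
theorem exists_meets_of_walk [Finite S] {x₁ x₂ x₃ x₄ : RelArtinVertex M T} (h₁₂ : Meets x₁ x₂)
    (h₂₃ : Meets x₂ x₃) (h₃₄ : Meets x₃ x₄) (h₄₁ : Meets x₄ x₁)
    (w : ((dynkinDiagram M).induce T).Walk x₃.1 x₂.1) :
    ∃ y : RelArtinVertex M T, y.1 ∈ w.support ∧ Meets y x₁ ∧ Meets y x₂ ∧ Meets y x₄ := by
  obtain ⟨⟨a, ha⟩, q₁⟩ := x₁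
  obtain ⟨⟨b, hb⟩, q₂⟩ := x₂
  obtain ⟨⟨c, hc⟩, q₃⟩ := x₃
  obtain ⟨⟨d, hd⟩, q₄⟩ := x₄
  obtain ⟨g, hg₁, hg₂⟩ := h₁₂
  obtain ⟨g', hg'₂, hg'₃⟩ := h₂₃
  obtain ⟨g'', hg''₃, hg''₄⟩ := h₃₄
  obtain ⟨g''', hg'''₄, hg'''₁⟩ := h₄₁
  dsimp only at *
  obtain ⟨r, hr, k₁, k₂, hk₁a, hk₁b, hk, hk₂a, hk₂d⟩ := exists_projection
    (w.map (Embedding.induce T).toHom) (h := g'''⁻¹ * g) (k := g'⁻¹ * g) (y := g''⁻¹ * g')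
    (l := g'''⁻¹ * g'')
    (QuotientGroup.eq.mp (hg'''₁.trans hg₁.symm)) (QuotientGroup.eq.mp (hg'₂.trans hg₂.symm))
    (QuotientGroup.eq.mp (hg''₃.trans hg'₃.symm))
    (QuotientGroup.eq.mp (hg'''₄.trans hg''₄.symm)) (by group)
  rw [Walk.support_map, List.mem_map] at hr
  obtain ⟨r, hr, rfl⟩ := hr
  have hy₁ : (QuotientGroup.mk (g * k₁⁻¹) : ArtinGroup M ⧸ standardParabolic M {a}ᶜ) = q₁ := by
    rw [← hg₁]
    exact QuotientGroup.eq.mpr (by rwa [mul_inv_rev, inv_inv, inv_mul_cancel_right])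
  have hy₂ : (QuotientGroup.mk (g * k₁⁻¹) : ArtinGroup M ⧸ standardParabolic M {b}ᶜ) = q₂ := by
    rw [← hg₂]
    exact QuotientGroup.eq.mpr (by rwa [mul_inv_rev, inv_inv, inv_mul_cancel_right])
  refine ⟨⟨r, QuotientGroup.mk (g * k₁⁻¹)⟩, hr, ⟨_, rfl, hy₁⟩, ⟨_, rfl, hy₂⟩, g * k₂⁻¹, ?_, ?_⟩
  · refine QuotientGroup.eq.mpr ?_
    rw [mul_inv_rev, inv_inv, mul_assoc, inv_mul_cancel_left]
    exact hk
  · rw [← hg'''₄]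
    refine QuotientGroup.eq.mpr ?_
    rw [mul_inv_rev, inv_inv, ← mul_assoc] at hk₂d
    rw [mul_inv_rev, inv_inv]
    exact hk₂d

end Meets

/-! ### Four-cycles with labels in a tree -/

section FourCycles

open SimpleGraph

variable {S : Type*} {M : CoxeterMatrix S} {T : Set S}

/-- The labels of four vertices, as vertices of the tree spanned by `T`. -/
def labels (x₁ x₂ x₃ x₄ : RelArtinVertex M T) : Set T := {x₁.1, x₂.1, x₃.1, x₄.1}

/-- The four cosets have a common neighbour with label in the hull of their labels. -/
def HasCenter (x₁ x₂ x₃ x₄ : RelArtinVertex M T) : Prop :=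
  ∃ x : RelArtinVertex M T, Meets x x₁ ∧ Meets x x₂ ∧ Meets x x₃ ∧ Meets x x₄ ∧
    x.1 ∈ ((dynkinDiagram M).induce T).btwHull (labels x₁ x₂ x₃ x₄)

lemma labels_rotate (x₁ x₂ x₃ x₄ : RelArtinVertex M T) :
    labels x₂ x₃ x₄ x₁ = labels x₁ x₂ x₃ x₄ := by
  ext r
  simp only [labels, Set.mem_insert_iff, Set.mem_singleton_iff]
  tauto

lemma HasCenter.of_rotate {x₁ x₂ x₃ x₄ : RelArtinVertex M T} (h : HasCenter x₂ x₃ x₄ x₁) :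
    HasCenter x₁ x₂ x₃ x₄ := by
  obtain ⟨x, h2, h3, h4, h1, hx⟩ := h
  exact ⟨x, h1, h2, h3, h4, by rwa [← labels_rotate]⟩

/-- The label of `x₁` lies on no path joining two of the three other labels. -/
def IsOuter (x₁ x₂ x₃ x₄ : RelArtinVertex M T) : Prop :=
  x₁.1 ∉ ((dynkinDiagram M).induce T).btwHull {x₂.1, x₃.1, x₄.1}

/-- The separation property, in the form in which it restricts the labels of common neighbours of
two vertices whose cosets are disjoint. -/
lemma not_btw_of_not_meets (hadm : IsAdmissible (dynkinDiagram M) T)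
    {x y z : RelArtinVertex M T} (hxy : Meets x y) (hyz : Meets y z) (hxz : ¬ Meets x z) :
    ¬ ((dynkinDiagram M).induce T).Btw x.1 y.1 z.1 :=
  fun h => hxz (hxy.trans_of_btw hadm hyz h)

/-- In an induced 4-cycle whose first and third labels differ, one of these two is outer. -/
lemma isOuter_or_isOuter (htree : ((dynkinDiagram M).induce T).IsTree)
    (hadm : IsAdmissible (dynkinDiagram M) T) {x₁ x₂ x₃ x₄ : RelArtinVertex M T}
    (h : MeetsCycle x₁ x₂ x₃ x₄) (h₁₃ : x₁.1 ≠ x₃.1) :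
    IsOuter x₁ x₂ x₃ x₄ ∨ IsOuter x₃ x₄ x₁ x₂ := by
  set G := (dynkinDiagram M).induce T
  have hconn := htree.connected
  have n1 := not_btw_of_not_meets hadm h.meets₁₂.symm h.meets₄₁.symm h.not_meets₂₄
  unfold IsOuter
  by_contra! hcon
  obtain ⟨hc1, hc3⟩ := hcon
  have key1 : G.Btw x₃.1 x₁.1 x₂.1 ∨ G.Btw x₃.1 x₁.1 x₄.1 := by
    obtain ⟨v, hv, hb⟩ := exists_btw_of_mem_btwHull (u := x₃.1) hc1
    rcases hv with rfl | rfl | rfl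
    exacts [Or.inl hb, (h₁₃ hb.eq).elim, Or.inr hb]
  have key3 : G.Btw x₁.1 x₃.1 x₂.1 ∨ G.Btw x₁.1 x₃.1 x₄.1 := by
    obtain ⟨v, hv, hb⟩ := exists_btw_of_mem_btwHull (u := x₁.1) hc3
    rcases hv with rfl | rfl | rfl
    exacts [Or.inr hb, (h₁₃ hb.eq.symm).elim, Or.inl hb]
  have both : ∀ u, G.Btw x₁.1 x₃.1 u → ¬ G.Btw x₃.1 x₁.1 u :=
    fun u h3 h1 => h₁₃ (h3.symm.antisymm hconn h1.symm).symm
  -- As the label of `x₁` is not between those of `x₂` and `x₄`, it separates both from `x₃`.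
  have h1 : G.Btw x₃.1 x₁.1 x₂.1 ∧ G.Btw x₃.1 x₁.1 x₄.1 := by
    rcases key1 with k | k
    · rcases k.left_or_right x₄.1 with k' | k'
      exacts [⟨k, k'⟩, (n1 k'.symm).elim]
    · rcases k.left_or_right x₂.1 with k' | k'
      exacts [⟨k', k⟩, (n1 k').elim]
  rcases key3 with k | k
  exacts [both _ k h1.1, both _ k h1.2]

/-- The inductive step: an induced 4-cycle with outer first label has a center if all induced
4-cycles whose labels span a smaller subtree do. -/
lemma hasCenter_of_isOuter [Finite S] (htree : ((dynkinDiagram M).induce T).IsTree)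
    (hadm : IsAdmissible (dynkinDiagram M) T) {x₁ x₂ x₃ x₄ : RelArtinVertex M T}
    (h : MeetsCycle x₁ x₂ x₃ x₄) (hout : IsOuter x₁ x₂ x₃ x₄)
    (ih : ∀ y₁ y₂ y₃ y₄ : RelArtinVertex M T, MeetsCycle y₁ y₂ y₃ y₄ →
      ((dynkinDiagram M).induce T).btwHull (labels y₁ y₂ y₃ y₄) ⊂
        ((dynkinDiagram M).induce T).btwHull (labels x₁ x₂ x₃ x₄) →
      HasCenter y₁ y₂ y₃ y₄) :
    HasCenter x₁ x₂ x₃ x₄ := by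
  set G := (dynkinDiagram M).induce T with hG
  have hconn := htree.connected
  have mem : ∀ r ∈ labels x₁ x₂ x₃ x₄, r ∈ G.btwHull (labels x₁ x₂ x₃ x₄) :=
    fun r hr => subset_btwHull _ hr
  have m1 := mem x₁.1 (by simp [labels])
  have m2 := mem x₂.1 (by simp [labels])
  have m3 := mem x₃.1 (by simp [labels])
  have m4 := mem x₄.1 (by simp [labels])
  have sub : G.btwHull {x₂.1, x₃.1, x₄.1} ⊆ G.btwHull (labels x₁ x₂ x₃ x₄) := by
    apply btwHull_subset_btwHull
    rintro r (rfl | rfl | rfl) <;> assumption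
  -- No common neighbour of `x₂` and `x₄` has its label between theirs.
  have hN : ∀ n : RelArtinVertex M T, Meets n x₂ → Meets n x₄ → ¬ G.Btw x₂.1 n.1 x₄.1 :=
    fun n h2 h4 => not_btw_of_not_meets hadm h2.symm h4 h.not_meets₂₄
  -- Hence, on the subtree spanned by the labels of `x₂`, `x₃`, `x₄`, such a label lies on the
  -- branch of `x₃`.
  have branch : ∀ n : RelArtinVertex M T, Meets n x₂ → Meets n x₄ →
      n.1 ∈ G.btwHull {x₂.1, x₃.1, x₄.1} → G.Btw x₃.1 n.1 x₂.1 ∧ G.Btw x₃.1 n.1 x₄.1 := by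
    intro n h2 h4 hn
    obtain ⟨v, hv, hb⟩ := exists_btw_of_mem_btwHull (u := x₃.1) hn
    rcases hv with rfl | rfl | rfl
    · exact ⟨hb, (hb.left_or_right x₄.1).resolve_right fun h' => hN n h2 h4 h'.symm⟩
    · rw [hb.eq]
      exact ⟨btw_left _ _, btw_left _ _⟩
    · exact ⟨(hb.left_or_right x₂.1).resolve_right fun h' => hN n h2 h4 h', hb⟩
  -- Project `x₃` to the link of `x₁`.
  obtain ⟨p, hp, -⟩ := (hconn x₃.1 x₂.1).exists_path_of_dist
  obtain ⟨y, hyp, hy1, hy2, hy4⟩ := exists_meets_of_walk h.1 h.2 h.3 h.4 p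
  have hyB := htree.btw_of_mem_support hp hyp
  have hyH : y.1 ∈ G.btwHull {x₂.1, x₃.1, x₄.1} := ⟨x₃.1, by simp, x₂.1, by simp, hyB⟩
  have hyB4 := (branch y hy2 hy4 hyH).2
  by_cases hy3 : Meets y x₃
  · exact ⟨y, hy1, hy2, hy3, hy4, sub hyH⟩
  have hsub1 : G.btwHull (labels y x₂ x₃ x₄) ⊆ G.btwHull {x₂.1, x₃.1, x₄.1} := by
    apply btwHull_subset_btwHull
    rintro r (rfl | hr)
    exacts [hyH, subset_btwHull _ hr]
  obtain ⟨w, hwy, hw2, hw3, hw4, hwH⟩ := ih y x₂ x₃ x₄ ⟨hy2, h.2, h.3, hy4.symm, hy3, h.6⟩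
    ⟨hsub1.trans sub, fun h' => hout (hsub1 (h' m1))⟩
  obtain ⟨hwB2, hwB4⟩ := branch w hw2 hw4 (hsub1 hwH)
  have n1 : ¬ G.Btw y.1 w.1 x₃.1 := not_btw_of_not_meets hadm hwy.symm hw3 hy3
  have hyw : G.Btw w.1 y.1 x₃.1 := by
    have : G.Btw y.1 w.1 x₂.1 := (hwB2.left_or_right y.1).resolve_left fun h' => n1 h'.symm
    exact hyB.symm.trans_right hconn this.symm
  by_cases hw1 : Meets w x₁
  · exact ⟨w, hw1, hw2, hw3, hw4, sub (hsub1 hwH)⟩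
  have n2 : ¬ G.Btw w.1 y.1 x₁.1 := not_btw_of_not_meets hadm hwy hy1 hw1
  have hw3ne : w.1 ≠ x₃.1 := by
    intro h'
    rw [hw3.eq_of_label_eq h'] at hwy
    exact hy3 hwy.symm
  have hsub2 : G.btwHull (labels x₁ x₂ w x₄) ⊆ G.btwHull (labels x₁ x₂ x₃ x₄) := by
    apply btwHull_subset_btwHull
    rintro r (rfl | rfl | rfl | rfl)
    exacts [m1, m2, sub (hsub1 hwH), m4]
  have hx3 : x₃.1 ∉ G.btwHull (labels x₁ x₂ w x₄) := by
    intro h'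
    obtain ⟨v, hv, hb⟩ := exists_btw_of_mem_btwHull (u := w.1) h'
    rcases hv with rfl | rfl | rfl | rfl
    · exact n2 (hb.trans_left hyw)
    · exact hw3ne (hb.symm.antisymm hconn hwB2.symm).symm
    · exact hw3ne hb.eq.symm
    · exact hw3ne (hb.symm.antisymm hconn hwB4.symm).symm
  obtain ⟨z, hz1, hz2, hzw, hz4, hzH⟩ := ih x₁ x₂ w x₄
    ⟨h.1, hw2.symm, hw4, h.4, fun h' => hw1 h'.symm, h.6⟩ ⟨hsub2, fun h' => hx3 (h' m3)⟩
  refine ⟨z, hz1, hz2, ?_, hz4, hsub2 hzH⟩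
  have n3 : ¬ G.Btw w.1 z.1 x₁.1 := not_btw_of_not_meets hadm hzw.symm hz1 hw1
  have far : ∀ u, G.Btw x₃.1 w.1 u → G.Btw w.1 z.1 u → Meets z x₃ := fun u hu hz =>
    hzw.trans_of_btw hadm hw3 (hu.symm.trans_right hconn hz.symm)
  obtain ⟨v, hv, hb⟩ := exists_btw_of_mem_btwHull (u := w.1) hzH
  rcases hv with rfl | rfl | rfl | rfl
  · exact (n3 hb).elim
  · exact far _ hwB2 hb
  · exact (n3 (hb.eq ▸ btw_left _ _)).elim
  · exact far _ hwB4 hb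

/-- If the condition holds for 4-cycles with only two labels, then it holds for all. -/
theorem hasCenter_of_two_labels [Finite S] (htree : ((dynkinDiagram M).induce T).IsTree)
    (hadm : IsAdmissible (dynkinDiagram M) T)
    (h2 : ∀ x₁ x₂ x₃ x₄ : RelArtinVertex M T, MeetsCycle x₁ x₂ x₃ x₄ → x₁.1 = x₃.1 →
      x₂.1 = x₄.1 → HasCenter x₁ x₂ x₃ x₄)
    (x₁ x₂ x₃ x₄ : RelArtinVertex M T) (h : MeetsCycle x₁ x₂ x₃ x₄) :
    HasCenter x₁ x₂ x₃ x₄ := by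
  induction hH : ((dynkinDiagram M).induce T).btwHull (labels x₁ x₂ x₃ x₄) using
    WellFoundedLT.induction generalizing x₁ x₂ x₃ x₄ with
  | _ H ih =>
  subst hH
  have ih' : ∀ y₁ y₂ y₃ y₄ : RelArtinVertex M T, MeetsCycle y₁ y₂ y₃ y₄ →
      ((dynkinDiagram M).induce T).btwHull (labels y₁ y₂ y₃ y₄) ⊂
        ((dynkinDiagram M).induce T).btwHull (labels x₁ x₂ x₃ x₄) →
      HasCenter y₁ y₂ y₃ y₄ := fun y₁ y₂ y₃ y₄ hy hlt => ih _ hlt y₁ y₂ y₃ y₄ hy rfl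
  have main : ∀ y₁ y₂ y₃ y₄ : RelArtinVertex M T, MeetsCycle y₁ y₂ y₃ y₄ →
      labels y₁ y₂ y₃ y₄ = labels x₁ x₂ x₃ x₄ → y₁.1 ≠ y₃.1 → HasCenter y₁ y₂ y₃ y₄ := by
    intro y₁ y₂ y₃ y₄ hy hl hne
    rcases isOuter_or_isOuter htree hadm hy hne with ho | ho
    · exact hasCenter_of_isOuter htree hadm hy ho (by rwa [hl])
    · refine (hasCenter_of_isOuter htree hadm hy.rotate.rotate ho ?_).of_rotate.of_rotate
      rwa [labels_rotate, labels_rotate, hl]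
  by_cases h13 : x₁.1 = x₃.1
  · by_cases h24 : x₂.1 = x₄.1
    · exact h2 _ _ _ _ h h13 h24
    · exact (main _ _ _ _ h.rotate (labels_rotate _ _ _ _) h24).of_rotate
  · exact main _ _ _ _ h rfl h13

/-- Four-cycles with only two labels live in the relative complex of a linear subgraph. -/
lemma hasCenter_of_labeledFourWheel [Finite S] (htree : ((dynkinDiagram M).induce T).IsTree)
    (hlin : ∀ T'' : Set S, IsMaximalLinearSubgraph (dynkinDiagram M) T T'' → LabeledFourWheel M T'')
    {x₁ x₂ x₃ x₄ : RelArtinVertex M T} (h : MeetsCycle x₁ x₂ x₃ x₄) (h13 : x₁.1 = x₃.1)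
    (h24 : x₂.1 = x₄.1) : HasCenter x₁ x₂ x₃ x₄ := by
  set I : Set T := {r | ((dynkinDiagram M).induce T).Btw x₁.1 r x₂.1} with hI
  have hlinI := isLinearSubgraph_interval htree x₁.1 x₂.1
  obtain ⟨T'', hIT, hmax⟩ := exists_isMaximalLinearSubgraph
    (by rintro _ ⟨r, -, rfl⟩; exact r.2) hlinI
  have hT'' := labeledFourWheel_iff.mp (hlin T'' hmax)
  have u1 : (x₁.1 : S) ∈ Subtype.val '' I := ⟨_, btw_left _ _, rfl⟩
  have u2 : (x₂.1 : S) ∈ Subtype.val '' I := ⟨_, btw_right _ _, rfl⟩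
  have u3 : (x₃.1 : S) ∈ Subtype.val '' I := h13 ▸ u1
  have u4 : (x₄.1 : S) ∈ Subtype.val '' I := h24 ▸ u2
  obtain ⟨x, hx1, hx2, hx3, hx4, hx⟩ := hT'' _ _ _ _
    (meetsCycle_changeType h (hIT u1) (hIT u2) (hIT u3) (hIT u4))
  obtain ⟨r, hr, hrx⟩ := hx (Subtype.val '' I) ⟨hIT, by
      rintro _ (rfl | rfl | rfl | rfl) <;> assumption,
    isTree_induce_of_isLinearSubgraph htree (hIT.trans hmax.prop.1) hlinI⟩
  have hxT : (x.1 : S) ∈ T := hrx ▸ r.2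
  refine ⟨changeType x hxT, hx1, hx2, hx3, hx4, x₁.1, by simp [labels], x₂.1, by simp [labels], ?_⟩
  have : (changeType x hxT).1 = r := Subtype.ext hrx.symm
  rw [this]
  exact hr

end FourCycles

theorem mainTheorem9 {S : Type*} [Finite S] (M : CoxeterMatrix S) (T : Set S)
    (htree : ((dynkinDiagram M).induce T).IsTree)
    (hadm : IsAdmissible (dynkinDiagram M) T) :
    LabeledFourWheel M T ↔
      ∀ T'' : Set S, IsMaximalLinearSubgraph (dynkinDiagram M) T T'' →
        LabeledFourWheel M T'' := by
  constructor
  · intro hW T'' hmax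
    have hT'' := hmax.prop.1
    rw [labeledFourWheel_iff] at hW ⊢
    intro x₁ x₂ x₃ x₄ h
    obtain ⟨x, h1, h2, h3, h4, hx⟩ := hW _ _ _ _ (meetsCycle_changeType h (hT'' x₁.1.2)
      (hT'' x₂.1.2) (hT'' x₃.1.2) (hT'' x₄.1.2))
    -- A subtree of the linear subgraph is a subtree of the whole tree, and the linear subgraph
    -- is itself one.
    have hxT : (x.1 : S) ∈ T'' := hx T'' ⟨hT'', by
      rintro _ (rfl | rfl | rfl | rfl)
      exacts [x₁.1.2, x₂.1.2, x₃.1.2, x₄.1.2],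
      isTree_induce_of_isLinearSubgraph htree hT'' hmax.prop.2⟩
    exact ⟨changeType x hxT, h1, h2, h3, h4, fun U hU => hx U ⟨hU.1.trans hT'', hU.2⟩⟩
  · intro hlin
    rw [labeledFourWheel_iff]
    intro x₁ x₂ x₃ x₄ h
    obtain ⟨x, h1, h2, h3, h4, hx⟩ := hasCenter_of_two_labels htree hadm
      (fun _ _ _ _ h h13 h24 => hasCenter_of_labeledFourWheel htree hlin h h13 h24) _ _ _ _ h
    refine ⟨x, h1, h2, h3, h4, coe_mem_smallestSubtree hx ?_⟩
    rintro u (rfl | rfl | rfl | rfl) <;> simp
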